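/- Let $\mathcal A^0$ be the flag algebra (over the empty type) of the theory of tournaments: it consists of the formal real linear combinations of isomorphism classes of finite tournaments (including the tournament with no vertices, which is the unit), modulo the linear relations $$F=\sum_{|G|=n}p(F;G)\,G\qquad(n\ge |F|),$$ where $p(F;G)$ is the probability that a uniformly random set of $|F|$ vertices of $G$ induces a copy of $F$. Its product is given by $$F_1\cdot F_2=\sum_{|G|=|F_1|+|F_2|}p(F_1,F_2;G)\,G,$$ where $p(F_1,F_2;G)$ is the probability that two uniformly random disjoint sets of $|F_1|$ and $|F_2|$ vertices of $G$ induce copies of $F_1$ and of $F_2$, respectively. Let $\mathrm{Hom}^+(\mathcal A^0,\mathbb R)$ be the set of real algebra homomorphisms $\phi:\mathcal A^0\to\mathbb R$ with $\phi(F)\ge 0$ for every finite tournament $F$. Let $\phi_{\mathrm{rdm}}\in\mathrm{Hom}^+(\mathcal A^0,\mathbb R)$ be the quasi-random homomorphism, that is, the limit of the random tournaments in which every arc is oriented independently with probability $1/2$; its value $\phi_{\mathrm{rdm}}(F)$ is the probability that such a random tournament on $|F|$ labelled vertices is isomorphic to $F$. Let $\mathrm{Tr}_k$ be the transitive tournament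 with $k$ vertices. **Theorem.** For every $k\in\mathbb N$ (including $k=0$) and every $\phi\in\mathrm{Hom}^+(\mathcal A^0,\mathbb R)$, $$\phi(\mathrm{Tr}_k)\ \ge\ \frac{k!}{2^{\binom k2}},$$ and $\phi_{\mathrm{rdm}}(\mathrm{Tr}_k)=k!/2^{\binom k2}$, so that random tournaments asymptotically minimize the density of $\mathrm{Tr}_k$. Moreover, for every fixed $k\ge 4$ and every $\phi\in\mathrm{Hom}^+(\mathcal A^0,\mathbb R)$, the equality $\phi(\mathrm{Tr}_k)=k!/2^{\binom k2}$ holds if and only if $\phi=\phi_{\mathrm{rdm}}$. -/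

import Mathlib

open scoped BigOperators

/-- A tournament on the vertex set `V`: a digraph without loops in which every two distinct vertices
are joined by exactly one arc. `T.Adj v w` means that `v` beats `w`. -/
@[ext]
structure Tournament (V : Type*) extends Digraph V where
  /-- No two vertices beat each other; in particular there are no loops. -/
  asymm : ∀ v w, Adj v w → ¬ Adj w v
  /-- Any two distinct vertices are joined by an arc. -/
  total : ∀ v w, v ≠ w → Adj v w ∨ Adj w v

namespace Tournament

variable {U V W : Type*}

/-- The tournament induced along an injective map of the vertices. -/
def comap (T : Tournament W) (e : V ↪ W) : Tournament V where
  Adj v w := T.Adj (e v) (e w)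
  asymm v w := T.asymm (e v) (e w)
  total v w h := T.total (e v) (e w) (e.injective.ne h)

theorem comap_comap (T : Tournament W) (f : V ↪ W) (e : U ↪ V) :
    (T.comap f).comap e = T.comap (e.trans f) := rfl

/-- Two tournaments are isomorphic if some bijection of the vertices preserves the arcs. -/
def Iso (S : Tournament V) (T : Tournament W) : Prop := Nonempty (S.Adj ≃r T.Adj)

theorem Iso.comap {S T : Tournament V} (h : S.Iso T) :
    ∃ σ : V ≃ V, S = T.comap σ.toEmbedding := by
  obtain ⟨r⟩ := h
  refine ⟨r.toEquiv, ?_⟩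
  ext v w
  exact r.map_rel_iff.symm

theorem iso_comap (T : Tournament V) (σ : V ≃ V) : (T.comap σ.toEmbedding).Iso T :=
  ⟨⟨σ, Iff.rfl⟩⟩

/-- Isomorphism as an equivalence relation on the tournaments with a given vertex set. -/
instance isoSetoid (V : Type*) : Setoid (Tournament V) where
  r := Iso
  iseqv := ⟨fun _ => ⟨RelIso.refl _⟩, fun ⟨r⟩ => ⟨r.symm⟩, fun ⟨r⟩ ⟨s⟩ => ⟨r.trans s⟩⟩

/-- The transitive tournament of a linear order: smaller vertices beat larger ones. -/
def transitive (V : Type*) [LinearOrder V] : Tournament V where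
  Adj v w := v < w
  asymm _ _ h := h.asymm
  total _ _ h := lt_or_gt_of_ne h

instance [Finite V] : Finite (Tournament V) := by
  refine Finite.of_injective (fun T : Tournament V => T.Adj) ?_
  intro S T h
  ext v w
  exact iff_of_eq (congrFun (congrFun h v) w)

noncomputable instance [Finite V] : Fintype (Tournament V) := Fintype.ofFinite _

instance [LinearOrder V] : Nonempty (Tournament V) := ⟨transitive V⟩

end Tournament

namespace TournamentFlags

open Tournament

/-! ### Models and densities -/

/-- Isomorphism classes of tournaments with `n` vertices. -/
abbrev Model (n : ℕ) : Type := Quotient (isoSetoid (Fin n))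

noncomputable instance (n : ℕ) : Fintype (Model n) := Fintype.ofFinite _

/-- Isomorphism classes of finite tournaments: the set of all flags over the empty type. -/
abbrev Flag : Type := Σ n : ℕ, Model n

/-- The isomorphism class of a tournament on `Fin n`. -/
def cls {n : ℕ} (T : Tournament (Fin n)) : Model n := Quotient.mk (isoSetoid (Fin n)) T

theorem cls_comap {n : ℕ} (T : Tournament (Fin n)) (σ : Fin n ≃ Fin n) :
    cls (T.comap σ.toEmbedding) = cls T := Quotient.sound (T.iso_comap σ)

open Classical in
/-- The indicator, as a real number, that the tournament `T` represents the class `F`. -/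
noncomputable def ind {n : ℕ} (F : Model n) (T : Tournament (Fin n)) : ℝ :=
  if cls T = F then 1 else 0

theorem ind_nonneg {n : ℕ} (F : Model n) (T : Tournament (Fin n)) : 0 ≤ ind F T := by
  unfold ind; split_ifs <;> norm_num

theorem sum_mul_ind {n : ℕ} (T : Tournament (Fin n)) (f : Model n → ℝ) :
    ∑ F, f F * ind F T = f (cls T) := by
  classical
  simp [ind]

/-- For `k ≤ n`, the density `p(F; T)`: the probability that a uniformly random injective map of `k`
vertices into the vertices of `T` (equivalently, its image, a uniformly random set of `k`
vertices) induces a copy of `F`. -/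
noncomputable def dens {k n : ℕ} (F : Model k) (T : Tournament (Fin n)) : ℝ :=
  𝔼 e : Fin k ↪ Fin n, ind F (T.comap e)

/-- For `k + l ≤ n`, the joint density `p(F₁, F₂; T)`: the probability that the two parts of a uniformly
random injective map of `k + l` vertices into those of `T` (that is, two uniformly random
disjoint sets of `k` and of `l` vertices) induce copies of `F₁` and of `F₂`. -/
noncomputable def dens₂ {k l n : ℕ} (F₁ : Model k) (F₂ : Model l) (T : Tournament (Fin n)) : ℝ :=
  𝔼 e : Fin k ⊕ Fin l ↪ Fin n,
    ind F₁ (T.comap (Function.Embedding.inl.trans e)) *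
      ind F₂ (T.comap (Function.Embedding.inr.trans e))

/-! ### Averages over injective maps -/

section Averages

variable {α β γ : Type} [Fintype α] [Fintype β] [Fintype γ]

theorem exists_perm_trans (e e' : α ↪ γ) :
    ∃ σ : Equiv.Perm γ, e.trans σ.toEmbedding = e' := by
  classical
  let r : {x // x ∈ Set.range e} ≃ {x // x ∈ Set.range e'} :=
    (Equiv.ofInjective e e.injective).symm.trans (Equiv.ofInjective e' e'.injective)
  refine ⟨r.extendSubtype, ?_⟩
  ext a
  have h := r.extendSubtype_apply_of_mem (e a) ⟨a, rfl⟩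
  simp only [Function.Embedding.trans_apply, Equiv.coe_toEmbedding]
  rw [h]
  have h2 : (Equiv.ofInjective e e.injective).symm ⟨e a, ⟨a, rfl⟩⟩ = a := by
    rw [Equiv.symm_apply_eq]; rfl
  simp only [r, Equiv.trans_apply, h2]
  rfl

variable [DecidableEq γ]

/-- Right multiplication by a permutation, as a bijection of the injective maps. -/
def transPerm (σ : Equiv.Perm γ) : (α ↪ γ) ≃ (α ↪ γ) where
  toFun e := e.trans σ.toEmbedding
  invFun e := e.trans σ.symm.toEmbedding
  left_inv e := by ext; simp
  right_inv e := by ext; simp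

theorem expect_perm (e₀ : α ↪ γ) (f : (α ↪ γ) → ℝ) :
    𝔼 σ : Equiv.Perm γ, f (e₀.trans σ.toEmbedding) = 𝔼 e, f e := by
  have h1 : ∀ σ : Equiv.Perm γ, 𝔼 e, f e = 𝔼 e : α ↪ γ, f (e.trans σ.toEmbedding) := fun σ =>
    (Fintype.expect_equiv (transPerm σ) _ _ fun _ => rfl).symm
  have h2 : ∀ e : α ↪ γ, 𝔼 σ : Equiv.Perm γ, f (e.trans σ.toEmbedding) =
      𝔼 σ : Equiv.Perm γ, f (e₀.trans σ.toEmbedding) := by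
    intro e
    obtain ⟨τ, rfl⟩ := exists_perm_trans e₀ e
    exact Fintype.expect_equiv (Equiv.mulRight τ) _ _ fun σ => rfl
  have : Nonempty (α ↪ γ) := ⟨e₀⟩
  calc 𝔼 σ : Equiv.Perm γ, f (e₀.trans σ.toEmbedding)
      = 𝔼 e : α ↪ γ, 𝔼 σ : Equiv.Perm γ, f (e.trans σ.toEmbedding) := by
        simp only [h2, Fintype.expect_const]
    _ = 𝔼 σ : Equiv.Perm γ, 𝔼 e : α ↪ γ, f (e.trans σ.toEmbedding) := Finset.expect_comm _ _ _
    _ = 𝔼 e, f e := by simp only [← h1, Fintype.expect_const]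

/-- The restriction of a uniformly random injective map is a uniformly random injective map. -/
theorem expect_trans (h : Nonempty (β ↪ γ)) (g : α ↪ β) (f : (α ↪ γ) → ℝ) :
    𝔼 e : β ↪ γ, f (g.trans e) = 𝔼 e, f e := by
  obtain ⟨e₀⟩ := h
  rw [← expect_perm e₀ (fun e => f (g.trans e)), ← expect_perm (g.trans e₀) f]
  rfl

end Averages

theorem nonempty_emb {k n : ℕ} (h : k ≤ n) : Nonempty (Fin k ↪ Fin n) := ⟨Fin.castLEEmb h⟩

theorem nonempty_emb₂ {k l n : ℕ} (h : k + l ≤ n) : Nonempty (Fin k ⊕ Fin l ↪ Fin n) :=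
  ⟨finSumFinEquiv.toEmbedding.trans (Fin.castLEEmb h)⟩

theorem dens_comap {k n : ℕ} (F : Model k) (T : Tournament (Fin n)) (σ : Fin n ≃ Fin n) :
    dens F (T.comap σ.toEmbedding) = dens F T :=
  Fintype.expect_equiv (transPerm σ) _ _ fun _ => rfl

theorem dens₂_comap {k l n : ℕ} (F₁ : Model k) (F₂ : Model l) (T : Tournament (Fin n))
    (σ : Fin n ≃ Fin n) : dens₂ F₁ F₂ (T.comap σ.toEmbedding) = dens₂ F₁ F₂ T :=
  Fintype.expect_equiv (transPerm σ) _ _ fun _ => rfl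

/-- The density `p(F; G)` of isomorphism classes. -/
noncomputable def p {k n : ℕ} (F : Model k) (G : Model n) : ℝ :=
  Quotient.lift (dens F) (fun _ T h => by
    obtain ⟨σ, rfl⟩ := Iso.comap h
    exact dens_comap F T σ) G

/-- The joint density `p(F₁, F₂; G)` of isomorphism classes. -/
noncomputable def p₂ {k l n : ℕ} (F₁ : Model k) (F₂ : Model l) (G : Model n) : ℝ :=
  Quotient.lift (dens₂ F₁ F₂) (fun _ T h => by
    obtain ⟨σ, rfl⟩ := Iso.comap h
    exact dens₂_comap F₁ F₂ T σ) G

@[simp] theorem p_cls {k n : ℕ} (F : Model k) (T : Tournament (Fin n)) :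
    p F (cls T) = dens F T := rfl

@[simp] theorem p₂_cls {k l n : ℕ} (F₁ : Model k) (F₂ : Model l) (T : Tournament (Fin n)) :
    p₂ F₁ F₂ (cls T) = dens₂ F₁ F₂ T := rfl

theorem cls_surjective {n : ℕ} : Function.Surjective (cls (n := n)) := Quotient.mk_surjective

/-- The chain rule for densities. -/
theorem chain_p {k m n : ℕ} (hkm : k ≤ m) (hmn : m ≤ n) (F : Model k) (G : Model n) :
    ∑ H : Model m, p F H * p H G = p F G := by
  obtain ⟨T, rfl⟩ := cls_surjective G
  simp only [p_cls, dens, Finset.mul_expect, ← Finset.expect_sum_comm]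
  simp only [sum_mul_ind, p_cls, dens, comap_comap]
  rw [Finset.expect_comm]
  have := nonempty_emb hkm
  have h : ∀ e : Fin k ↪ Fin m, 𝔼 e' : Fin m ↪ Fin n, ind F (T.comap (e.trans e')) =
      𝔼 e : Fin k ↪ Fin n, ind F (T.comap e) := fun e =>
    expect_trans (nonempty_emb hmn) e fun e' => ind F (T.comap e')
  simp only [h, Fintype.expect_const]

theorem chain_p₂ {k l m n : ℕ} (hkm : k + l ≤ m) (hmn : m ≤ n) (F₁ : Model k) (F₂ : Model l)
    (G : Model n) : ∑ H : Model m, p₂ F₁ F₂ H * p H G = p₂ F₁ F₂ G := by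
  obtain ⟨T, rfl⟩ := cls_surjective G
  simp only [p_cls, dens, Finset.mul_expect, ← Finset.expect_sum_comm]
  simp only [sum_mul_ind, p₂_cls, dens₂, comap_comap]
  rw [Finset.expect_comm]
  have := nonempty_emb₂ hkm
  have h : ∀ e : Fin k ⊕ Fin l ↪ Fin m, 𝔼 e' : Fin m ↪ Fin n,
      ind F₁ (T.comap ((Function.Embedding.inl.trans e).trans e')) *
        ind F₂ (T.comap ((Function.Embedding.inr.trans e).trans e')) = dens₂ F₁ F₂ T := fun e =>
    expect_trans (nonempty_emb hmn) e fun e' => ind F₁ (T.comap (Function.Embedding.inl.trans e')) *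
      ind F₂ (T.comap (Function.Embedding.inr.trans e'))
  simp only [h, Fintype.expect_const]
  rfl

theorem p₂_comm {k l n : ℕ} (F₁ : Model k) (F₂ : Model l) (G : Model n) :
    p₂ F₁ F₂ G = p₂ F₂ F₁ G := by
  obtain ⟨T, rfl⟩ := cls_surjective G
  refine Fintype.expect_equiv (Equiv.embeddingCongr (Equiv.sumComm _ _) (Equiv.refl _)) _ _ ?_
  intro e
  rw [mul_comm]
  rfl

/-- The chain rule for the first argument of a joint density. -/
theorem chain_left {k l m n : ℕ} (hkm : k ≤ m) (hmn : m + l ≤ n) (F : Model k) (F₂ : Model l)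
    (G : Model n) : ∑ H : Model m, p F H * p₂ H F₂ G = p₂ F F₂ G := by
  obtain ⟨T, rfl⟩ := cls_surjective G
  simp only [p₂_cls, dens₂, Finset.mul_expect, ← Finset.expect_sum_comm, ← mul_assoc,
    ← Finset.sum_mul]
  simp only [sum_mul_ind, p_cls, dens, comap_comap, Finset.expect_mul]
  rw [Finset.expect_comm]
  have := nonempty_emb hkm
  have h : ∀ e : Fin k ↪ Fin m, 𝔼 e' : Fin m ⊕ Fin l ↪ Fin n,
      ind F (T.comap (e.trans (Function.Embedding.inl.trans e'))) *
        ind F₂ (T.comap (Function.Embedding.inr.trans e')) = dens₂ F F₂ T := fun e =>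
    expect_trans (nonempty_emb₂ hmn) (e.sumMap (Function.Embedding.refl (Fin l))) fun e' =>
      ind F (T.comap (Function.Embedding.inl.trans e')) *
      ind F₂ (T.comap (Function.Embedding.inr.trans e'))
  simp only [h, Fintype.expect_const]
  rfl

/-- The joint density of three classes. -/
noncomputable def dens₃ {a b c n : ℕ} (F₁ : Model a) (F₂ : Model b) (F₃ : Model c)
    (T : Tournament (Fin n)) : ℝ :=
  𝔼 e : (Fin a ⊕ Fin b) ⊕ Fin c ↪ Fin n,
    ind F₁ (T.comap ((Function.Embedding.inl.trans Function.Embedding.inl).trans e)) *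
      ind F₂ (T.comap ((Function.Embedding.inr.trans Function.Embedding.inl).trans e)) *
      ind F₃ (T.comap (Function.Embedding.inr.trans e))

theorem chain_assoc {a b c m n : ℕ} (hm : a + b ≤ m) (hmn : m + c ≤ n) (F₁ : Model a)
    (F₂ : Model b) (F₃ : Model c) (T : Tournament (Fin n)) :
    ∑ H : Model m, p₂ F₁ F₂ H * p₂ H F₃ (cls T) = dens₃ F₁ F₂ F₃ T := by
  simp only [p₂_cls, dens₂, Finset.mul_expect, ← Finset.expect_sum_comm, ← mul_assoc,
    ← Finset.sum_mul]
  simp only [sum_mul_ind, p₂_cls, dens₂, comap_comap, Finset.expect_mul]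
  rw [Finset.expect_comm]
  have := nonempty_emb₂ hm
  have h : ∀ e : Fin a ⊕ Fin b ↪ Fin m, 𝔼 e' : Fin m ⊕ Fin c ↪ Fin n,
      ind F₁ (T.comap ((Function.Embedding.inl.trans e).trans
        (Function.Embedding.inl.trans e'))) *
      ind F₂ (T.comap ((Function.Embedding.inr.trans e).trans
        (Function.Embedding.inl.trans e'))) *
      ind F₃ (T.comap (Function.Embedding.inr.trans e')) = dens₃ F₁ F₂ F₃ T := fun e =>
    expect_trans (nonempty_emb₂ hmn) (e.sumMap (Function.Embedding.refl (Fin c))) fun e' =>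
    ind F₁ (T.comap ((Function.Embedding.inl.trans Function.Embedding.inl).trans e')) *
      ind F₂ (T.comap ((Function.Embedding.inr.trans Function.Embedding.inl).trans e')) *
      ind F₃ (T.comap (Function.Embedding.inr.trans e'))
  simp only [h, Fintype.expect_const]

theorem dens₃_rotate {a b c n : ℕ} (F₁ : Model a) (F₂ : Model b) (F₃ : Model c)
    (T : Tournament (Fin n)) : dens₃ F₁ F₂ F₃ T = dens₃ F₂ F₃ F₁ T := by
  refine Fintype.expect_equiv (Equiv.embeddingCongr
    ((Equiv.sumAssoc _ _ _).trans (Equiv.sumComm _ _)) (Equiv.refl _)) _ _ ?_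
  intro e
  rw [mul_assoc, mul_comm]
  rfl

/-! ### The flag algebra -/

/-- The linear relations `F = ∑ p(F; G) G`, where `G` runs over the classes of tournaments with a
given number `n ≥ |F|` of vertices. -/
noncomputable def relations : Submodule ℝ (Flag →₀ ℝ) :=
  Submodule.span ℝ {x | ∃ (k n : ℕ) (_ : k ≤ n) (F : Model k),
    x = Finsupp.single ⟨k, F⟩ 1 - ∑ G : Model n, p F G • Finsupp.single (⟨n, G⟩ : Flag) (1 : ℝ)}

/-- The algebra `𝒜⁰` of the theory of tournaments: formal real linear combinations of isomorphism
classes of finite tournaments, modulo the linear relations above. -/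
def A0 : Type := (Flag →₀ ℝ) ⧸ relations

noncomputable instance : AddCommGroup A0 :=
  inferInstanceAs (AddCommGroup ((Flag →₀ ℝ) ⧸ relations))

noncomputable instance : Module ℝ A0 := inferInstanceAs (Module ℝ ((Flag →₀ ℝ) ⧸ relations))

/-- The quotient map. -/
noncomputable def toA0 : (Flag →₀ ℝ) →ₗ[ℝ] A0 := relations.mkQ

/-- A tournament (an isomorphism class) as an element of the algebra. -/
noncomputable def flag {n : ℕ} (F : Model n) : A0 := toA0 (Finsupp.single ⟨n, F⟩ 1)

theorem flag_eq_sum {k n : ℕ} (h : k ≤ n) (F : Model k) :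
    flag F = ∑ G : Model n, p F G • flag G := by
  have : toA0 (Finsupp.single ⟨k, F⟩ 1 - ∑ G : Model n, p F G •
      Finsupp.single (⟨n, G⟩ : Flag) (1 : ℝ)) = 0 :=
    (Submodule.Quotient.mk_eq_zero _).2 (Submodule.subset_span ⟨k, n, h, F, rfl⟩)
  rw [map_sub, sub_eq_zero, map_sum] at this
  simp only [map_smul] at this
  exact this

/-- The bilinear product `F₁ · F₂ = ∑ p(F₁, F₂; G) G` of formal linear combinations, where `G` runs
over the classes of tournaments with `|F₁| + |F₂|` vertices. -/
noncomputable def mulFree : (Flag →₀ ℝ) →ₗ[ℝ] (Flag →₀ ℝ) →ₗ[ℝ] A0 :=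
  Finsupp.linearCombination ℝ fun F₁ : Flag => Finsupp.linearCombination ℝ fun F₂ : Flag =>
    ∑ G : Model (F₁.1 + F₂.1), p₂ F₁.2 F₂.2 G • flag G

theorem mulFree_single {k l : ℕ} (F₁ : Model k) (F₂ : Model l) :
    mulFree (Finsupp.single ⟨k, F₁⟩ 1) (Finsupp.single ⟨l, F₂⟩ 1) =
      ∑ G : Model (k + l), p₂ F₁ F₂ G • flag G := by
  simp [mulFree]

/-- The product may be computed on any sufficiently large number of vertices. -/
theorem mulFree_single' {k l n : ℕ} (h : k + l ≤ n) (F₁ : Model k) (F₂ : Model l) :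
    mulFree (Finsupp.single ⟨k, F₁⟩ 1) (Finsupp.single ⟨l, F₂⟩ 1) =
      ∑ G : Model n, p₂ F₁ F₂ G • flag G := by
  rw [mulFree_single]
  calc ∑ H : Model (k + l), p₂ F₁ F₂ H • flag H
      = ∑ H : Model (k + l), ∑ G : Model n, (p₂ F₁ F₂ H * p H G) • flag G := by
        refine Finset.sum_congr rfl fun H _ => ?_
        rw [flag_eq_sum h H, Finset.smul_sum]
        simp only [smul_smul]
    _ = _ := by
        rw [Finset.sum_comm]
        simp only [← Finset.sum_smul, chain_p₂ le_rfl h]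

theorem mulFree_comm (x y : Flag →₀ ℝ) : mulFree x y = mulFree y x := by
  suffices mulFree = mulFree.flip from LinearMap.congr_fun₂ this x y
  ext ⟨k, F₁⟩ ⟨l, F₂⟩
  simp only [LinearMap.comp_apply, LinearMap.flip_apply, Finsupp.lsingle_apply]
  rw [mulFree_single' le_rfl, mulFree_single' (n := k + l) (by omega)]
  simp only [p₂_comm F₁ F₂]

theorem mulFree_relations {x : Flag →₀ ℝ} (hx : x ∈ relations) : mulFree x = 0 := by
  suffices relations ≤ LinearMap.ker mulFree from this hx
  refine Submodule.span_le.2 ?_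
  rintro _ ⟨k, n, h, F, rfl⟩
  refine LinearMap.mem_ker.2 ?_
  ext ⟨l, F₂⟩
  simp only [LinearMap.comp_apply, Finsupp.lsingle_apply, map_sub, map_sum, map_smul,
    LinearMap.sub_apply, LinearMap.sum_apply, LinearMap.smul_apply, LinearMap.zero_apply]
  rw [mulFree_single' (n := n + l) (by omega), sub_eq_zero]
  simp only [mulFree_single, Finset.smul_sum, smul_smul]
  rw [Finset.sum_comm]
  simp only [← Finset.sum_smul, chain_left h le_rfl]

/-- The product of `𝒜⁰` as a bilinear map. -/
noncomputable def mulA0 : A0 →ₗ[ℝ] A0 →ₗ[ℝ] A0 :=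
  mulFree.liftQ₂ relations relations (fun _ hx => LinearMap.mem_ker.2 (mulFree_relations hx))
    (fun y hy => LinearMap.mem_ker.2 (by
      ext x
      simp only [LinearMap.comp_apply, LinearMap.flip_apply, LinearMap.zero_apply]
      rw [mulFree_comm, mulFree_relations hy, LinearMap.zero_apply]))

noncomputable instance : Mul A0 := ⟨fun x y => mulA0 x y⟩

/-- The unit is the tournament without vertices. -/
noncomputable instance : One A0 := ⟨flag (cls (transitive (Fin 0)))⟩

theorem mul_def (x y : A0) : x * y = mulA0 x y := rfl

theorem one_def : (1 : A0) = flag (cls (transitive (Fin 0))) := rfl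

theorem flag_mul_flag {k l n : ℕ} (h : k + l ≤ n) (F₁ : Model k) (F₂ : Model l) :
    flag F₁ * flag F₂ = ∑ G : Model n, p₂ F₁ F₂ G • flag G :=
  mulFree_single' h F₁ F₂

/-- Two linear maps that agree on all tournaments are equal. -/
theorem linearMap_ext {M : Type*} [AddCommGroup M] [Module ℝ M] {f g : A0 →ₗ[ℝ] M}
    (h : ∀ (n : ℕ) (F : Model n), f (flag F) = g (flag F)) : f = g := by
  refine Submodule.linearMap_qext _ ?_
  ext ⟨n, F⟩
  exact h n F

theorem A0_mul_comm (x y : A0) : x * y = y * x := by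
  suffices mulA0 = mulA0.flip from LinearMap.congr_fun₂ this x y
  refine linearMap_ext fun k F₁ => linearMap_ext fun l F₂ => ?_
  exact mulFree_comm _ _

theorem A0_one_mul (x : A0) : 1 * x = x := by
  suffices mulA0 1 = LinearMap.id from LinearMap.congr_fun this x
  refine linearMap_ext fun n F => ?_
  rw [← mul_def, one_def, flag_mul_flag (n := n) (by omega), LinearMap.id_apply,
    flag_eq_sum le_rfl F]
  refine Finset.sum_congr rfl fun G _ => ?_
  congr 1
  obtain ⟨T, rfl⟩ := cls_surjective G
  have h0 : ∀ S : Tournament (Fin 0), ind (cls (transitive (Fin 0))) S = 1 := by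
    intro S
    have : S = transitive (Fin 0) := by ext v; exact v.elim0
    simp [ind, this]
  simp only [p₂_cls, p_cls, dens₂, dens, h0, one_mul]
  exact expect_trans (nonempty_emb₂ (by omega)) Function.Embedding.inr fun e => ind F (T.comap e)

theorem flag_mul_mul {a b c n : ℕ} (h : a + b + c ≤ n) (F₁ : Model a) (F₂ : Model b)
    (F₃ : Model c) :
    flag F₁ * flag F₂ * flag F₃ = ∑ G : Model n, dens₃ F₁ F₂ F₃ (Quotient.out G) • flag G := by
  rw [flag_mul_flag le_rfl, mul_def, map_sum, LinearMap.sum_apply]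
  simp only [map_smul, LinearMap.smul_apply, ← mul_def, flag_mul_flag h, Finset.smul_sum,
    smul_smul]
  rw [Finset.sum_comm]
  simp only [← Finset.sum_smul]
  refine Finset.sum_congr rfl fun G _ => ?_
  rw [← chain_assoc le_rfl h, show cls G.out = G from Quotient.out_eq G]

/-- An additive property that holds for the multiples of all tournaments holds everywhere. -/
theorem A0_induction {P : A0 → Prop} (h0 : P 0) (hadd : ∀ x y, P x → P y → P (x + y))
    (hflag : ∀ (r : ℝ) (n : ℕ) (F : Model n), P (r • flag F)) (x : A0) : P x := by
  obtain ⟨x, rfl⟩ := Submodule.mkQ_surjective relations x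
  induction x using Finsupp.induction_linear with
  | zero => exact (map_zero relations.mkQ).symm ▸ h0
  | add f g hf hg => exact (map_add relations.mkQ f g).symm ▸ hadd _ _ hf hg
  | single F r =>
    have h := hflag r F.1 F.2
    rw [flag, ← map_smul, Finsupp.smul_single, smul_eq_mul, mul_one] at h
    exact h

theorem A0_mul_assoc (x y z : A0) : x * y * z = x * (y * z) := by
  simp only [mul_def]
  induction x using A0_induction with
  | h0 => simp only [map_zero, LinearMap.zero_apply]
  | hadd x x' hx hx' => simp only [map_add, LinearMap.add_apply, hx, hx']
  | hflag r a F₁ =>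
    induction y using A0_induction with
    | h0 => simp only [map_zero, LinearMap.zero_apply]
    | hadd y y' hy hy' => simp only [map_add, LinearMap.add_apply, hy, hy']
    | hflag s b F₂ =>
      induction z using A0_induction with
      | h0 => simp only [map_zero]
      | hadd z z' hz hz' => simp only [map_add, hz, hz']
      | hflag t c F₃ =>
        simp only [map_smul, LinearMap.smul_apply]
        congr 3
        simp only [← mul_def]
        rw [A0_mul_comm (flag F₁) (flag F₂ * flag F₃), flag_mul_mul (n := a + b + c) le_rfl,
          flag_mul_mul (n := a + b + c) (by omega)]
        simp only [dens₃_rotate F₁]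

noncomputable instance : CommRing A0 :=
  { (inferInstance : AddCommGroup A0) with
    mul := (· * ·)
    one := 1
    left_distrib := fun x y z => map_add (mulA0 x) y z
    right_distrib := fun x y z => LinearMap.map_add₂ mulA0 x y z
    zero_mul := fun x => LinearMap.map_zero₂ mulA0 x
    mul_zero := fun x => map_zero (mulA0 x)
    mul_assoc := A0_mul_assoc
    one_mul := A0_one_mul
    mul_one := fun x => (A0_mul_comm x 1).trans (A0_one_mul x)
    mul_comm := A0_mul_comm }

noncomputable instance : Algebra ℝ A0 :=
  Algebra.ofModule (fun r x y => LinearMap.map_smul₂ mulA0 r x y)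
    (fun r x y => map_smul (mulA0 x) r y)

/-- `Hom⁺(𝒜⁰, ℝ)`: the algebra homomorphisms to `ℝ` that are nonnegative on all tournaments. -/
abbrev PosHom : Type := {φ : A0 →ₐ[ℝ] ℝ // ∀ (n : ℕ) (F : Model n), 0 ≤ φ (flag F)}

/-! ### The random tournament -/

section Random

variable {V W : Type}

/-- Reverse the arcs between the pairs of vertices selected by `s`. -/
def reverse (T : Tournament V) (s : Sym2 V → Bool) : Tournament V where
  Adj v w := if s s(v, w) then T.Adj w v else T.Adj v w
  asymm v w := by
    rw [Sym2.eq_swap (a := w) (b := v)]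
    split_ifs
    · exact T.asymm w v
    · exact T.asymm v w
  total v w h := by
    rw [Sym2.eq_swap (a := w) (b := v)]
    split_ifs
    · exact T.total w v h.symm
    · exact T.total v w h

theorem reverse_reverse (T : Tournament V) (s : Sym2 V → Bool) :
    reverse (reverse T s) s = T := by
  ext v w
  simp only [reverse, Sym2.eq_swap (a := w) (b := v)]
  split_ifs <;> rfl

/-- Reversing a fixed set of arcs is a bijection. -/
def reverseEquiv (s : Sym2 V → Bool) : Tournament V ≃ Tournament V where
  toFun T := reverse T s
  invFun T := reverse T s
  left_inv T := reverse_reverse T s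
  right_inv T := reverse_reverse T s

theorem exists_reverse (S T : Tournament V) : ∃ s, reverse S s = T := by
  classical
  refine ⟨fun z => decide (∃ v w, z = s(v, w) ∧ S.Adj v w ∧ T.Adj w v), ?_⟩
  ext v w
  simp only [reverse, decide_eq_true_eq]
  have h1 := S.asymm v w
  have h2 := T.asymm v w
  by_cases hvw : v = w
  · subst hvw
    simp_all
  have h3 := S.total v w hvw
  have h4 := T.total v w hvw
  have h : (∃ v' w', s(v, w) = s(v', w') ∧ S.Adj v' w' ∧ T.Adj w' v') ↔
      (S.Adj v w ∧ T.Adj w v) ∨ (S.Adj w v ∧ T.Adj v w) := by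
    constructor
    · rintro ⟨a, b, hab, h⟩
      rcases Sym2.eq_iff.1 hab with ⟨rfl, rfl⟩ | ⟨rfl, rfl⟩
      · exact Or.inl h
      · exact Or.inr h
    · rintro (h | h)
      · exact ⟨v, w, rfl, h⟩
      · exact ⟨w, v, Sym2.eq_swap, h⟩
  simp only [h]
  split_ifs with h' <;> tauto

theorem reverse_comap (T : Tournament W) (e : V ↪ W) (s : Sym2 W → Bool) :
    (reverse T s).comap e = reverse (T.comap e) (fun z => s (z.map e)) := rfl

theorem expect_reverse [Fintype V] [DecidableEq V] (S : Tournament V) (f : Tournament V → ℝ) :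
    𝔼 s : Sym2 V → Bool, f (reverse S s) = 𝔼 T, f T := by
  have h1 : ∀ s, 𝔼 T, f (reverse T s) = 𝔼 T, f T := fun s =>
    Fintype.expect_equiv (reverseEquiv s) _ _ fun _ => rfl
  have h2 : ∀ T, 𝔼 s : Sym2 V → Bool, f (reverse T s) = 𝔼 s : Sym2 V → Bool, f (reverse S s) := by
    intro T
    obtain ⟨t, rfl⟩ := exists_reverse S T
    refine Fintype.expect_equiv
      (Function.Involutive.toPerm (fun s z => xor (t z) (s z)) ?_) _ _ ?_
    · intro s
      funext z
      simp
    · intro s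
      congr 1
      ext v w
      change _ ↔ if xor (t s(v, w)) (s s(v, w)) then _ else _
      simp only [reverse, Sym2.eq_swap (a := w) (b := v)]
      cases t s(v, w) <;> cases s s(v, w) <;> simp
  have : Nonempty (Tournament V) := ⟨S⟩
  calc 𝔼 s : Sym2 V → Bool, f (reverse S s)
      = 𝔼 T : Tournament V, 𝔼 s : Sym2 V → Bool, f (reverse T s) := by
        simp only [h2, Fintype.expect_const]
    _ = 𝔼 s : Sym2 V → Bool, 𝔼 T : Tournament V, f (reverse T s) := Finset.expect_comm _ _ _
    _ = 𝔼 T, f T := by simp only [h1, Fintype.expect_const]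

/-- Disjoint sets of vertices of a random tournament induce independent random tournaments. -/
theorem expect_comap_mul {U : Type} [Fintype U] [DecidableEq U] [Finite W] (e : U ↪ W) (e' : V ↪ W)
    (hd : ∀ a b, e a ≠ e' b) (f : Tournament U → ℝ) (g : Tournament V → ℝ) :
    𝔼 T : Tournament W, f (T.comap e) * g (T.comap e') =
      (𝔼 S, f S) * 𝔼 T : Tournament W, g (T.comap e') := by
  let ext : (Sym2 U → Bool) → Sym2 W → Bool := fun s =>
    Function.extend (Sym2.map e) s fun _ => false
  have h1 : ∀ (T : Tournament W) s, (reverse T (ext s)).comap e = reverse (T.comap e) s := by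
    intro T s
    rw [reverse_comap]
    congr 1
    funext z
    exact (Sym2.map.injective e.injective).extend_apply _ _ _
  have h2 : ∀ (T : Tournament W) s, (reverse T (ext s)).comap e' = T.comap e' := by
    intro T s
    ext v w
    have : ext s s(e' v, e' w) = false := by
      refine Function.extend_apply' _ _ _ ?_
      rintro ⟨y, hy⟩
      have : e' v ∈ Sym2.map e y := by rw [hy]; exact Sym2.mem_mk_left _ _
      obtain ⟨a, -, ha⟩ := Sym2.mem_map.1 this
      exact hd _ _ ha
    simp [reverse, Tournament.comap, this]
  calc 𝔼 T : Tournament W, f (T.comap e) * g (T.comap e')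
      = 𝔼 s : Sym2 U → Bool, 𝔼 T : Tournament W, f ((reverse T (ext s)).comap e) *
          g ((reverse T (ext s)).comap e') := by
        have h3 : ∀ s : Sym2 W → Bool, 𝔼 T : Tournament W, f ((reverse T s).comap e) *
            g ((reverse T s).comap e') = 𝔼 T : Tournament W, f (T.comap e) * g (T.comap e') :=
          fun s => Fintype.expect_equiv (reverseEquiv s) _ _ fun _ => rfl
        simp only [h3, Fintype.expect_const]
    _ = 𝔼 T : Tournament W, (𝔼 S, f S) * g (T.comap e') := by
        rw [Finset.expect_comm]
        simp only [h1, h2, ← Finset.expect_mul, expect_reverse]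
    _ = _ := by rw [Finset.mul_expect]

end Random

/-- The probability that the random tournament on `n` vertices, in which every arc is oriented
independently and uniformly (a uniformly random element of the set of tournaments on `Fin n`), is a
copy of `F`. -/
noncomputable def rdm {n : ℕ} (F : Model n) : ℝ := 𝔼 T : Tournament (Fin n), ind F T

theorem expect_joint {k l n : ℕ} (F₁ : Model k) (F₂ : Model l) (e : Fin k ⊕ Fin l ↪ Fin n) :
    𝔼 T : Tournament (Fin n), ind F₁ (T.comap (Function.Embedding.inl.trans e)) *
      ind F₂ (T.comap (Function.Embedding.inr.trans e)) = rdm F₁ * rdm F₂ := by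
  rw [expect_comap_mul _ _ (fun a b h => by simpa using e.injective h)]
  have := expect_comap_mul (Function.Embedding.inr.trans e) (Fin.castLEEmb (Nat.zero_le n))
    (fun _ b => b.elim0) (ind F₂) (fun _ => 1)
  simp only [mul_one, Fintype.expect_const] at this
  rw [this]
  rfl

/-- The expected density of `F` in the random tournament on `n ≥ |F|` vertices does not depend on
`n`. -/
theorem sum_p_rdm {k n : ℕ} (h : k ≤ n) (F : Model k) :
    ∑ G : Model n, p F G * rdm G = rdm F := by
  simp only [rdm, Finset.mul_expect, ← Finset.expect_sum_comm, sum_mul_ind, p_cls, dens]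
  rw [Finset.expect_comm]
  have := nonempty_emb h
  have h' : ∀ e : Fin k ↪ Fin n, 𝔼 T : Tournament (Fin n), ind F (T.comap e) = rdm F := by
    intro e
    have := expect_comap_mul e (Fin.castLEEmb (Nat.zero_le n))
      (fun _ b => b.elim0) (ind F) (fun _ => 1)
    simp only [mul_one, Fintype.expect_const] at this
    exact this
  simp only [h', Fintype.expect_const]
  rfl

theorem sum_p₂_rdm {k l n : ℕ} (h : k + l ≤ n) (F₁ : Model k) (F₂ : Model l) :
    ∑ G : Model n, p₂ F₁ F₂ G * rdm G = rdm F₁ * rdm F₂ := by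
  conv_lhs => simp only [rdm, Finset.mul_expect, ← Finset.expect_sum_comm, sum_mul_ind, p₂_cls,
    dens₂]
  rw [Finset.expect_comm]
  have := nonempty_emb₂ h
  simp only [expect_joint, Fintype.expect_const]

/-- The linear functional on `𝒜⁰` whose value at `F` is the expected density of `F` in the random
tournament. -/
noncomputable def rdmLin : A0 →ₗ[ℝ] ℝ :=
  relations.liftQ (Finsupp.linearCombination ℝ fun F : Flag => rdm F.2) (by
    refine Submodule.span_le.2 ?_
    rintro _ ⟨k, n, h, F, rfl⟩
    refine LinearMap.mem_ker.2 ?_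
    simp [sum_p_rdm h])

theorem rdmLin_flag {n : ℕ} (F : Model n) : rdmLin (flag F) = rdm F := by
  refine (Submodule.liftQ_apply _ _ _).trans ?_
  simp

theorem rdmLin_one : rdmLin 1 = 1 := by
  rw [one_def, rdmLin_flag, rdm]
  have h : ∀ T : Tournament (Fin 0), ind (cls (transitive (Fin 0))) T = 1 := by
    intro T
    have : T = transitive (Fin 0) := by ext v; exact v.elim0
    simp [ind, this]
  simp only [h, Fintype.expect_const]

theorem rdmLin_mul (x y : A0) : rdmLin (x * y) = rdmLin x * rdmLin y := by
  suffices mulA0.compr₂ rdmLin = (LinearMap.mul ℝ ℝ).compl₁₂ rdmLin rdmLin from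
    LinearMap.congr_fun₂ this x y
  refine linearMap_ext fun k F₁ => linearMap_ext fun l F₂ => ?_
  simp only [LinearMap.compr₂_apply, LinearMap.compl₁₂_apply, LinearMap.mul_apply', ← mul_def,
    flag_mul_flag le_rfl, map_sum, map_smul, rdmLin_flag, smul_eq_mul, sum_p₂_rdm le_rfl]

/-- The quasi-random homomorphism `φ_rdm`, the limit of random tournaments in which all arcs are
oriented independently with probability `1/2`. Its value at `F` is the expected density of `F` in
the random tournament on `n` vertices, which is the same for all `n ≥ |F|`. -/
noncomputable def phiRdm : PosHom :=
  ⟨AlgHom.ofLinearMap rdmLin rdmLin_one rdmLin_mul, fun n F => by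
    rw [AlgHom.ofLinearMap_apply, rdmLin_flag]
    exact Finset.expect_nonneg fun T _ => ind_nonneg F T⟩

/-- The transitive tournament with `k` vertices, as an element of `𝒜⁰`. -/
noncomputable def Tr (k : ℕ) : A0 := flag (cls (transitive (Fin k)))

end TournamentFlags

/-! No limit object is needed. For each `n`, `φ` restricts to a probability distribution on the
classes of `n`-vertex tournaments (`sum_flag`), and `φ(F)` is the average of the density of `F`
under it. A finite tournament becomes a kernel `W` with `W x y + W y x = 1` by putting `1/2` on the
diagonal. Passing from injective maps to all maps costs an error tending to zero uniformly over
tournaments, so normalized values of `φ` are limits of average homomorphism densities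
(`tendsto_average_homDens`). It remains to prove inequalities for finite kernels.

Lower bound (`le_transDens`): induct on `k`, for weighted densities. Choosing the top vertex `x`
replaces the weight `u` by its restriction to the out-neighbourhood of `x`, of mass `v x`. Since a
symmetric weight sees `W` as `1/2`, the `u`-mean of `v` is exactly half the mean of `u`, and
convexity of `v ^ k` closes the induction.

Equality (`discrepancy_le`): choose the top two vertices together. The remaining `k - 2` lie in
their common out-neighbourhood, of mass `X x y`, and contribute at least a multiple of `X ^ (k -
2)`. For `k ≥ 4` the exponent is at least 2, so convexity leaves a quadratic gain. This gain,
together with the variance of the out-degrees, dominates the discrepancy, a 4-cycle density of `W -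
1/2`. A minimizing `φ` thus has average discrepancy tending to zero. By the counting lemma
(`homDens_sub_pow_four_le`), small discrepancy forces all labelled densities towards the random
value. Hence `φ` agrees with `phiRdm` on every tournament, and tournaments span the algebra. -/

/-! ### Tournament kernels on finite spaces -/

/-- A tournament kernel: the values `W x y` and `W y x` are complementary probabilities. -/
structure IsTournamentKernel {Ω : Type*} (W : Ω → Ω → ℝ) : Prop where
  nonneg : ∀ x y, 0 ≤ W x y
  add_swap : ∀ x y, W x y + W y x = 1

/-- `v ^ (r + 2)` lies above its tangent at `c` by at least `c ^ r * (v - c) ^ 2`. -/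
theorem tangent_add_sq_le_pow {c v : ℝ} (hc : 0 ≤ c) (hv : 0 ≤ v) (r : ℕ) :
    c ^ (r + 2) + (r + 2) * c ^ (r + 1) * (v - c) + c ^ r * (v - c) ^ 2 ≤ v ^ (r + 2) := by
  induction r with
  | zero => exact le_of_eq (by push_cast; ring)
  | succ r ih =>
    -- Multiplying the inductive bound by `v` overshoots the next one by exactly the expression in
    -- `h2`.
    have h := mul_le_mul_of_nonneg_left ih hv
    have h2 : 0 ≤ c ^ r * (v - c) ^ 2 * ((r + 1) * c + v) := by positivity
    push_cast
    linear_combination h + h2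

/-- `v ^ k` lies above its tangent at `c`. -/
theorem tangent_le_pow {c v : ℝ} (hc : 0 ≤ c) (hv : 0 ≤ v) (k : ℕ) :
    c ^ k + k * c ^ (k - 1) * (v - c) ≤ v ^ k := by
  match k with
  -- The truncated exponent `k - 1` is harmless at `k = 0`, where the factor `k` kills the linear
  -- term.
  | 0 => simp
  | 1 => simp
  | r + 2 =>
    have h := tangent_add_sq_le_pow hc hv r
    have h2 : 0 ≤ c ^ r * (v - c) ^ 2 := by positivity
    push_cast
    simpa using by linarith

namespace IsTournamentKernel

variable {Ω : Type*} {W : Ω → Ω → ℝ}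

theorem swap (h : IsTournamentKernel W) (x y : Ω) : W y x = 1 - W x y := by
  linarith [h.add_swap x y]

theorem le_one (h : IsTournamentKernel W) (x y : Ω) : W x y ≤ 1 := by
  linarith [h.add_swap x y, h.nonneg y x]

end IsTournamentKernel

section FiniteAverages

variable {Ω : Type*} [Fintype Ω]

theorem sq_expect_le_expect_sq [Nonempty Ω] (f : Ω → ℝ) : (𝔼 x, f x) ^ 2 ≤ 𝔼 x, f x ^ 2 := by
  have h := Finset.expect_mul_sq_le_sq_mul_sq Finset.univ f (fun _ => (1 : ℝ))
  simpa [Fintype.expect_const] using h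

theorem expect_mono {f g : Ω → ℝ} (h : ∀ x, f x ≤ g x) : 𝔼 x, f x ≤ 𝔼 x, g x :=
  Finset.expect_le_expect fun x _ => h x

end FiniteAverages

/-! ### Lower bounds on transitive densities by convexity. -/

section Kernel

variable {Ω : Type*} [Fintype Ω] {W : Ω → Ω → ℝ}

/-- The density of transitive tournaments with `k` vertices, weighted by `u`, in the kernel `W`. -/
noncomputable def transDens (W : Ω → Ω → ℝ) : ℕ → (Ω → ℝ) → ℝ
  | 0, _ => 1
  | k + 1, u => 𝔼 x, u x * transDens W k (fun y => u y * W x y)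

/-- How far the kernel is from being quasi-random: the density of 4-cycles in `W - 1/2`, up to
sign. -/
noncomputable def discrepancy (W : Ω → Ω → ℝ) : ℝ :=
  𝔼 x, 𝔼 y, (𝔼 z, (W x z - 1 / 2) * (W y z - 1 / 2)) ^ 2

namespace IsTournamentKernel

/-- Exchanging `x` and `y` turns `W x y` into `1 - W x y` and leaves `s` alone. This is the only
source of exact evaluations in the convexity argument. -/
theorem expect_symm_mul (h : IsTournamentKernel W) (s : Ω → Ω → ℝ) (hs : ∀ x y, s x y = s y x) :
    𝔼 x, 𝔼 y, s x y * W x y = (𝔼 x, 𝔼 y, s x y) / 2 := by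
  have h1 : 𝔼 x, 𝔼 y, s x y * W x y = 𝔼 x, 𝔼 y, s x y * W y x := by
    rw [Finset.expect_comm]
    simp only [hs]
  have h2 : 𝔼 x, 𝔼 y, s x y * W x y + 𝔼 x, 𝔼 y, s x y * W y x = 𝔼 x, 𝔼 y, s x y := by
    simp only [← Finset.expect_add_distrib, ← mul_add, h.add_swap, mul_one]
  linarith

/-- The weight `u` is general because the induction descends to out-neighbourhoods. The step is
Jensen's inequality for `v ^ k` under the weight `u`, with the tangent line written out so that the
total weight may vanish. -/
theorem le_transDens [Nonempty Ω] (h : IsTournamentKernel W) (k : ℕ) :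
    ∀ u : Ω → ℝ, (∀ x, 0 ≤ u x) → (𝔼 x, u x) ^ k / 2 ^ k.choose 2 ≤ transDens W k u := by
  induction k with
  | zero => intro u _; simp [transDens]
  | succ k ih =>
    intro u hu
    set m := 𝔼 x, u x with hm
    have hm0 : 0 ≤ m := Finset.expect_nonneg fun x _ => hu x
    set v : Ω → ℝ := fun x => 𝔼 y, u y * W x y with hv
    have hv0 : ∀ x, 0 ≤ v x := fun x =>
      Finset.expect_nonneg fun y _ => mul_nonneg (hu y) (h.nonneg x y)
    have huv : 𝔼 x, u x * v x = m ^ 2 / 2 := by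
      have := h.expect_symm_mul (fun x y => u x * u y) (fun x y => mul_comm _ _)
      rw [← Finset.expect_mul_expect, ← sq] at this
      rw [← this]
      simp only [hv, Finset.mul_expect, mul_assoc]
    -- The tangent is taken at `m / 2`, the `u`-weighted mean of `v` by `huv`, so that its linear
    -- term averages to zero.
    have h1 : ∀ x, u x * ((m / 2) ^ k + k * (m / 2) ^ (k - 1) * (v x - m / 2)) / 2 ^ k.choose 2 ≤
        u x * transDens W k (fun y => u y * W x y) := by
      intro x
      rw [mul_div_assoc]
      refine mul_le_mul_of_nonneg_left (le_trans ?_ (ih _ fun y => mul_nonneg (hu y) (h.nonneg x y)))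
        (hu x)
      exact div_le_div_of_nonneg_right (tangent_le_pow (by positivity) (hv0 x) k) (by positivity)
    refine le_trans (le_of_eq ?_) (expect_mono h1)
    have h2 : ∀ x, u x * ((m / 2) ^ k + k * (m / 2) ^ (k - 1) * (v x - m / 2)) / 2 ^ k.choose 2 =
      ((m / 2) ^ k - k * (m / 2) ^ (k - 1) * (m / 2)) / 2 ^ k.choose 2 * u x +
        k * (m / 2) ^ (k - 1) / 2 ^ k.choose 2 * (u x * v x) := fun x => by ring
    simp only [h2, Finset.expect_add_distrib, ← Finset.mul_expect, huv, ← hm]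
    rw [Nat.choose_succ_succ' k 1, Nat.choose_one_right, pow_add, div_pow m 2 k]
    -- The slope cancels, so it may be treated as an arbitrary number.
    generalize (k : ℝ) * (m / 2) ^ (k - 1) = a
    field_simp
    ring

theorem transDens_add_two [Nonempty Ω] (W : Ω → Ω → ℝ) (r : ℕ) :
    transDens W (r + 2) (fun _ => 1) =
      𝔼 x, 𝔼 y, W x y * transDens W r (fun z => W x z * W y z) := by
  simp only [transDens, one_mul]

/-- Kernels that are not quasi-random have a larger density of transitive tournaments. -/
theorem discrepancy_le [Nonempty Ω] (h : IsTournamentKernel W) (r : ℕ) :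
    1 / 2 ^ (r + 4).choose 2 + (1 / 4) ^ r / 8 / 2 ^ (r + 2).choose 2 * discrepancy W ≤
      transDens W (r + 4) (fun _ => 1) := by
  set X : Ω → Ω → ℝ := fun x y => 𝔼 z, W x z * W y z with hX
  have hX0 : ∀ x y, 0 ≤ X x y := fun x y =>
    Finset.expect_nonneg fun z _ => mul_nonneg (h.nonneg x z) (h.nonneg y z)
  have hXs : ∀ x y, X x y = X y x := fun x y => by simp only [hX, mul_comm]
  set g : Ω → ℝ := fun x => 𝔼 y, (W x y - 1 / 2) with hg
  set D := 𝔼 x, g x ^ 2 with hD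
  set V := 𝔼 x, 𝔼 y, (X x y - 1 / 4) ^ 2 with hV
  have hD0 : 0 ≤ D := Finset.expect_nonneg fun x _ => sq_nonneg _
  have hW : 𝔼 x, 𝔼 y, W x y = 1 / 2 := by
    have := h.expect_symm_mul (fun _ _ => 1) (fun _ _ => rfl)
    simpa [Fintype.expect_const] using this
  have hgW : ∀ x, 𝔼 y, W x y = g x + 1 / 2 := fun x => by
    simp only [hg, Finset.expect_sub_distrib, Fintype.expect_const]; ring
  have hg0 : 𝔼 x, g x = 0 := by
    simp only [hgW, Finset.expect_add_distrib, Fintype.expect_const] at hW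
    linarith
  -- For fixed `x` the weight `W x y * W x z` is symmetric in `y` and `z`, so the factor `W y z`
  -- averages to `1/2` and leaves half the squared out-degree of `x`. The excess over `1/8` is half
  -- the degree variance `D`.
  have hWX : 𝔼 x, 𝔼 y, W x y * X x y = D / 2 + 1 / 8 := by
    have h1 : ∀ x, 𝔼 y, W x y * X x y = 𝔼 y, 𝔼 z, (W x y * W x z) * W y z := fun x => by
      simp only [hX, Finset.mul_expect, mul_assoc]
    have h2 : ∀ x, 𝔼 y, W x y * X x y = (g x + 1 / 2) ^ 2 / 2 := fun x => by
      rw [h1, h.expect_symm_mul (fun y z => W x y * W x z) (fun _ _ => mul_comm _ _),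
        ← Finset.expect_mul_expect, ← hgW, sq]
    have h3 : ∀ x, (g x + 1 / 2) ^ 2 / 2 = 1 / 2 * g x ^ 2 + 1 / 2 * g x + 1 / 8 := fun x => by ring
    simp only [h2, h3, Finset.expect_add_distrib, ← Finset.mul_expect, Fintype.expect_const, hg0,
      ← hD]
    ring
  have hWV : 𝔼 x, 𝔼 y, W x y * (X x y - 1 / 4) ^ 2 = V / 2 := by
    have := h.expect_symm_mul (fun x y => (X x y - 1 / 4) ^ 2) (fun x y => by simp only [hXs x y])
    rw [← this]
    simp only [mul_comm]
  -- The codegree of `W - 1/2` is that of `W`, centred at `1/4`, minus half the sum of the two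
  -- degree deviations.
  have hQ : discrepancy W ≤ 2 * V + 2 * D := by
    have h1 : ∀ x y, 𝔼 z, (W x z - 1 / 2) * (W y z - 1 / 2) =
        (X x y - 1 / 4) - 1 / 2 * (g x + g y) := fun x y => by
      have : ∀ z, (W x z - 1 / 2) * (W y z - 1 / 2) =
        W x z * W y z - 1 / 2 * W x z - 1 / 2 * W y z + 1 / 4 := fun z => by ring
      simp only [this, Finset.expect_add_distrib, Finset.expect_sub_distrib, ← Finset.mul_expect,
        Fintype.expect_const, hgW, hX]
      ring
    have h2 : ∀ x y, (𝔼 z, (W x z - 1 / 2) * (W y z - 1 / 2)) ^ 2 ≤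
        2 * (X x y - 1 / 4) ^ 2 + (g x ^ 2 + g y ^ 2) := fun x y => by
      rw [h1]
      nlinarith [sq_nonneg (X x y - 1 / 4 + 1 / 2 * (g x + g y)), sq_nonneg (g x - g y)]
    refine (expect_mono fun x => expect_mono (h2 x)).trans (le_of_eq ?_)
    simp only [Finset.expect_add_distrib, ← Finset.mul_expect, Fintype.expect_const, ← hV, ← hD]
    ring
  have hV0 : 0 ≤ V := Finset.expect_nonneg fun x _ => Finset.expect_nonneg fun y _ => sq_nonneg _
  obtain ⟨c, hc⟩ : ∃ c : ℝ, c = 1 / 4 := ⟨_, rfl⟩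
  obtain ⟨K, hK⟩ : ∃ K : ℝ, K = 2 ^ (r + 2).choose 2 := ⟨_, rfl⟩
  have hc0 : 0 ≤ c := by rw [hc]; norm_num
  have hK0 : 0 < K := by rw [hK]; exact pow_pos two_pos _
  have hVc : ∀ x y, X x y - 1 / 4 = X x y - c := fun x y => by rw [hc]
  simp only [hVc] at hWV
  rw [← hK, ← hc]
  have hlow : ∀ x y, W x y * ((c ^ (r + 2) + (r + 2) * c ^ (r + 1) * (X x y - c) +
      c ^ r * (X x y - c) ^ 2) / K) ≤ W x y * transDens W (r + 2) (fun z => W x z * W y z) :=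
    fun x y => mul_le_mul_of_nonneg_left
      ((div_le_div_of_nonneg_right (tangent_add_sq_le_pow hc0 (hX0 x y) r) hK0.le).trans
        (hK ▸ h.le_transDens (r + 2) _ fun z => mul_nonneg (h.nonneg x z) (h.nonneg y z))) (h.nonneg x y)
  have hchoose : (2 : ℝ) ^ (r + 4).choose 2 = K * (2 * 4 ^ (r + 2)) := by
    have : (r + 4).choose 2 = (r + 2).choose 2 + (1 + 2 * (r + 2)) := by
      rw [Nat.choose_succ_succ' (r + 3) 1, Nat.choose_succ_succ' (r + 2) 1, Nat.choose_one_right,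
        Nat.choose_one_right]
      ring
    rw [this, pow_add, pow_add, pow_mul]
    norm_num [hK]
  rw [transDens_add_two]
  refine le_trans ?_ (expect_mono fun x => expect_mono (hlow x))
  have hexp : ∀ x y, W x y * ((c ^ (r + 2) + (r + 2) * c ^ (r + 1) * (X x y - c) +
      c ^ r * (X x y - c) ^ 2) / K) = (c ^ (r + 2) - (r + 2) * c ^ (r + 1) * c) / K * W x y +
      (r + 2) * c ^ (r + 1) / K * (W x y * X x y) + c ^ r / K * (W x y * (X x y - c) ^ 2) :=
    fun x y => by ring
  simp only [hexp, Finset.expect_add_distrib, ← Finset.mul_expect, hW, hWX, hWV]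
  have hc4 : (1 : ℝ) / 2 ^ (r + 4).choose 2 = c ^ (r + 2) / 2 / K := by
    rw [hchoose, hc, div_pow, one_pow]
    field_simp
  rw [hc4]
  clear_value V D
  have h1 : c ^ r / 8 / K * discrepancy W ≤ c ^ r / 8 / K * (2 * V + 2 * D) :=
    mul_le_mul_of_nonneg_left hQ (by positivity)
  have h2 : 0 ≤ c ^ r / K * D * (r / 8) := by positivity
  -- Up to the factor `c ^ r / K`, the tangent gains `(r + 2) / 8 * D` and the square gains `V / 2`,
  -- while the discrepancy bound uses `(V + D) / 4`. The constant `1/8` in the statement consumes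
  -- the whole `D` term when `r = 0`.
  have h4 : (c ^ (r + 2) - (r + 2) * c ^ (r + 1) * c) / K * (1 / 2) +
      (r + 2) * c ^ (r + 1) / K * (D / 2 + 1 / 8) + c ^ r / K * (V / 2) -
      (c ^ (r + 2) / 2 / K + c ^ r / 8 / K * (2 * V + 2 * D)) =
      c ^ r / K * D * (r / 8) + c ^ r / K * V / 4 := by
    simp only [pow_succ, hc]
    ring
  have h5 : 0 ≤ c ^ r / K * V / 4 := by positivity
  linarith

end IsTournamentKernel
end Kernel

/-! ### Homomorphism densities -/

section Counting

variable {Ω V : Type*}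

open Classical in
/-- The weight in `W` of the image under `e` of the pair `p`, oriented as in `S`. -/
noncomputable def arcWeight (S : Tournament V) (W : Ω → Ω → ℝ) (e : V → Ω) (p : V × V) : ℝ :=
  if S.Adj p.1 p.2 then W (e p.1) (e p.2) else W (e p.2) (e p.1)

theorem arcWeight_congr (S : Tournament V) (W : Ω → Ω → ℝ) {e e' : V → Ω} {p : V × V}
    (h1 : e p.1 = e' p.1) (h2 : e p.2 = e' p.2) : arcWeight S W e p = arcWeight S W e' p := by
  simp only [arcWeight, h1, h2]

theorem IsTournamentKernel.arcWeight_nonneg {W : Ω → Ω → ℝ} (h : IsTournamentKernel W)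
    (S : Tournament V) (e : V → Ω) (p : V × V) :
    0 ≤ arcWeight S W e p := by
  unfold arcWeight; split_ifs <;> exact h.nonneg _ _

theorem IsTournamentKernel.arcWeight_le_one {W : Ω → Ω → ℝ} (h : IsTournamentKernel W)
    (S : Tournament V) (e : V → Ω) (p : V × V) :
    arcWeight S W e p ≤ 1 := by
  unfold arcWeight; split_ifs <;> exact h.le_one _ _

variable [Fintype Ω]

/-- The density of labelled copies of `S` in the kernel `W`. -/
noncomputable def homDens {k : ℕ} (S : Tournament (Fin k)) (W : Ω → Ω → ℝ) : ℝ :=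
  𝔼 e : Fin k → Ω, ∏ p : Fin k × Fin k with p.1 < p.2, arcWeight S W e p

theorem prod_pairs_eq_prod_Ioi {k : ℕ} (f : Fin k → Fin k → ℝ) :
    ∏ p : Fin k × Fin k with p.1 < p.2, f p.1 p.2 = ∏ i, ∏ j ∈ Finset.Ioi i, f i j := by
  rw [Finset.prod_filter, ← Finset.univ_product_univ, Finset.prod_product]
  refine Finset.prod_congr rfl fun i _ => ?_
  rw [← Finset.prod_filter]
  exact Finset.prod_congr (by ext j; simp) fun _ _ => rfl

theorem expect_fin_succ {k : ℕ} (f : (Fin (k + 1) → Ω) → ℝ) :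
    𝔼 e, f e = 𝔼 x, 𝔼 e : Fin k → Ω, f (Fin.cons x e) := by
  rw [← Finset.expect_product', Finset.univ_product_univ]
  exact (Fintype.expect_equiv (Fin.consEquiv fun _ => Ω) _ _ fun _ => rfl).symm

/-- Unrolling the recursion: the vertex split off is `0`, and its arcs to later vertices are
absorbed into their weights. -/
theorem transDens_eq_expect [Nonempty Ω] (W : Ω → Ω → ℝ) (k : ℕ) (u : Ω → ℝ) :
    transDens W k u =
      𝔼 e : Fin k → Ω, (∏ i, u (e i)) * ∏ i, ∏ j ∈ Finset.Ioi i, W (e i) (e j) := by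
  induction k generalizing u with
  | zero => simp [transDens]
  | succ k ih =>
    rw [transDens, expect_fin_succ]
    refine Finset.expect_congr rfl fun x _ => ?_
    rw [ih, Finset.mul_expect]
    refine Finset.expect_congr rfl fun e _ => ?_
    simp only [Fin.prod_univ_succ (n := k), Fin.prod_Ioi_zero, Fin.prod_Ioi_succ, Fin.cons_zero,
      Fin.cons_succ, Finset.prod_mul_distrib]
    ring

theorem homDens_transitive [Nonempty Ω] (W : Ω → Ω → ℝ) (k : ℕ) :
    homDens (Tournament.transitive (Fin k)) W = transDens W k (fun _ => 1) := by
  rw [transDens_eq_expect, homDens]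
  refine Finset.expect_congr rfl fun e _ => ?_
  rw [← prod_pairs_eq_prod_Ioi (fun i j => W (e i) (e j))]
  simp only [Finset.prod_const_one, one_mul]
  refine Finset.prod_congr rfl fun p hp => ?_
  exact if_pos (Finset.mem_filter.1 hp).2

theorem discrepancy_nonneg (W : Ω → Ω → ℝ) : 0 ≤ discrepancy W :=
  Finset.expect_nonneg fun _ _ => Finset.expect_nonneg fun _ _ => sq_nonneg _

theorem abs_prod_le_one {ι : Type*} (s : Finset ι) (f : ι → ℝ) (h0 : ∀ i, 0 ≤ f i)
    (h1 : ∀ i, f i ≤ 1) : |∏ i ∈ s, f i| ≤ 1 := by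
  rw [abs_of_nonneg (Finset.prod_nonneg fun i _ => h0 i)]
  exact Finset.prod_le_one (fun i _ => h0 i) fun i _ => h1 i

/-! ### The counting lemma: small discrepancy controls all densities. -/

namespace IsTournamentKernel

variable {W : Ω → Ω → ℝ}

/-- The bilinear form of `W - 1/2` is controlled by the discrepancy. -/
theorem abs_expect_le [Nonempty Ω] (h : IsTournamentKernel W) {a b : Ω → ℝ} (ha : ∀ x, |a x| ≤ 1)
    (hb : ∀ x, |b x| ≤ 1) {ε : ℝ} (hε : 0 ≤ ε) (hQ : discrepancy W ≤ ε ^ 4) :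
    |𝔼 x, 𝔼 y, (W x y - 1 / 2) * (a x * b y)| ≤ ε := by
  have sq_mul_le : ∀ {s t : ℝ}, |s| ≤ 1 → (s * t) ^ 2 ≤ t ^ 2 := fun {s t} hs => by
    rw [mul_pow]
    exact mul_le_of_le_one_left (sq_nonneg t) ((sq_le_one_iff_abs_le_one s).2 hs)
  set z := 𝔼 x, 𝔼 y, (W x y - 1 / 2) * (a x * b y) with hz
  set q := 𝔼 x, (𝔼 y, (W x y - 1 / 2) * b y) ^ 2 with hq
  have h1 : z ^ 2 ≤ q := by
    have : z = 𝔼 x, a x * 𝔼 y, (W x y - 1 / 2) * b y := by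
      simp only [hz, Finset.mul_expect]
      refine Finset.expect_congr rfl fun x _ => Finset.expect_congr rfl fun y _ => by ring
    rw [this]
    exact (sq_expect_le_expect_sq _).trans (expect_mono fun x => sq_mul_le (ha x))
  -- `W - 1/2` is antisymmetric. Swapping the arguments in both factors costs two signs, which
  -- cancel, and produces the codegrees in `discrepancy`.
  have h2 : q = 𝔼 y, 𝔼 y', (b y * b y') * 𝔼 x, (W y x - 1 / 2) * (W y' x - 1 / 2) := by
    have : ∀ x, (𝔼 y, (W x y - 1 / 2) * b y) ^ 2 =
        𝔼 y, 𝔼 y', (b y * b y') * ((W y x - 1 / 2) * (W y' x - 1 / 2)) := fun x => by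
      rw [sq, Finset.expect_mul_expect]
      refine Finset.expect_congr rfl fun y _ => Finset.expect_congr rfl fun y' _ => ?_
      rw [h.swap x y, h.swap x y']
      ring
    simp only [hq, this]
    rw [Finset.expect_comm]
    refine Finset.expect_congr rfl fun y _ => ?_
    rw [Finset.expect_comm]
    simp only [Finset.mul_expect]
  have h3 : q ^ 2 ≤ discrepancy W := by
    rw [h2]
    refine (sq_expect_le_expect_sq _).trans (expect_mono fun y => ?_)
    refine (sq_expect_le_expect_sq _).trans (expect_mono fun y' => sq_mul_le ?_)
    rw [abs_mul]
    exact mul_le_one₀ (hb y) (abs_nonneg _) (hb y')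
  have h4 : |q| ≤ ε ^ 2 := abs_le_of_sq_le_sq (by nlinarith) (by positivity)
  exact abs_le_of_sq_le_sq (h1.trans ((le_abs_self q).trans h4)) hε

end IsTournamentKernel

section Update

variable [Fintype V] [DecidableEq V]

/-- Resampling a coordinate does not change an average. -/
theorem expect_update [Nonempty Ω] (i : V) (f : (V → Ω) → ℝ) :
    𝔼 e : V → Ω, f e = 𝔼 e : V → Ω, 𝔼 x, f (Function.update e i x) := by
  -- Exchange coordinate `i` with the fresh sample.
  let σ : (V → Ω) × Ω ≃ (V → Ω) × Ω := Function.Involutive.toPerm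
    (fun z => (Function.update z.1 i z.2, z.1 i)) (fun z => by simp)
  calc 𝔼 e : V → Ω, f e = 𝔼 e : V → Ω, 𝔼 _x : Ω, f e := by simp only [Fintype.expect_const]
    _ = 𝔼 z : (V → Ω) × Ω, f z.1 := by
      rw [← Finset.univ_product_univ, Finset.expect_product]
    _ = 𝔼 z : (V → Ω) × Ω, f (Function.update z.1 i z.2) :=
      (Fintype.expect_equiv σ _ _ fun _ => rfl).symm
    _ = _ := by rw [← Finset.univ_product_univ, Finset.expect_product]

end Update

namespace IsTournamentKernel

variable {W : Ω → Ω → ℝ}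

/-- With all images but those of `i` and `j` fixed, only the pair `(i, j)` couples the two. Since it
is not in `P`, the product splits as `a x * b y` and the bilinear estimate applies. -/
theorem abs_expect_mul_prod_le [Nonempty Ω] [Fintype V] [LinearOrder V] (h : IsTournamentKernel W)
    (S : Tournament V) {ε : ℝ} (hε : 0 ≤ ε) (hQ : discrepancy W ≤ ε ^ 4) {i j : V} (hij : i < j)
    (P : Finset (V × V)) (hP : ∀ p ∈ P, p.1 < p.2) (hn : (i, j) ∉ P) :
    |𝔼 e : V → Ω, (W (e i) (e j) - 1 / 2) * ∏ p ∈ P, arcWeight S W e p| ≤ ε := by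
  rw [expect_update i, expect_update j]
  refine (Finset.abs_expect_le _ _).trans ?_
  refine Finset.expect_le Finset.univ_nonempty fun e _ => ?_
  rw [Finset.expect_comm]
  set a : Ω → ℝ := fun x => ∏ p ∈ P with ¬ (p.1 = j ∨ p.2 = j),
    arcWeight S W (Function.update e i x) p with ha
  set b : Ω → ℝ := fun y => ∏ p ∈ P with (p.1 = j ∨ p.2 = j),
    arcWeight S W (Function.update e j y) p with hb
  have hab : ∀ x y, ∏ p ∈ P, arcWeight S W (Function.update (Function.update e j y) i x) p =
      a x * b y := by
    intro x y
    rw [← Finset.prod_filter_mul_prod_filter_not P (fun p => p.1 = j ∨ p.2 = j), mul_comm]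
    congr 1
    · refine Finset.prod_congr rfl fun p hp => ?_
      have := (Finset.mem_filter.1 hp).2
      push Not at this
      rw [Function.update_comm hij.ne']
      exact arcWeight_congr S W (Function.update_of_ne this.1 _ _)
        (Function.update_of_ne this.2 _ _)
    · refine Finset.prod_congr rfl fun p hp => ?_
      obtain ⟨hpP, hpj⟩ := Finset.mem_filter.1 hp
      have hp12 := hP p hpP
      have h1 : p.1 ≠ i := by
        rintro rfl
        rcases hpj with hpj | hpj
        · exact hij.ne hpj
        · exact hn (by rwa [← hpj])
      have h2 : p.2 ≠ i := by
        rintro rfl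
        rcases hpj with hpj | hpj
        · exact absurd (hpj ▸ hp12) hij.asymm
        · exact hij.ne hpj
      exact arcWeight_congr S W (Function.update_of_ne h1 _ _) (Function.update_of_ne h2 _ _)
  have hW : ∀ x y, W (Function.update (Function.update e j y) i x i)
      (Function.update (Function.update e j y) i x j) = W x y := fun x y => by
    rw [Function.update_self, Function.update_of_ne hij.ne', Function.update_self]
  simp only [hab, hW]
  exact h.abs_expect_le (fun x => abs_prod_le_one _ _ (h.arcWeight_nonneg S _)
    (h.arcWeight_le_one S _)) (fun x => abs_prod_le_one _ _ (h.arcWeight_nonneg S _)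
    (h.arcWeight_le_one S _)) hε hQ

/-- The counting lemma. -/
theorem abs_expect_prod_sub_le [Nonempty Ω] [Fintype V] [LinearOrder V] (h : IsTournamentKernel W)
    (S : Tournament V) {ε : ℝ} (hε : 0 ≤ ε) (hQ : discrepancy W ≤ ε ^ 4)
    (P : Finset (V × V)) (hP : ∀ p ∈ P, p.1 < p.2) :
    |𝔼 e : V → Ω, ∏ p ∈ P, arcWeight S W e p - (1 / 2) ^ P.card| ≤ P.card * ε := by
  induction P using Finset.induction_on with
  | empty => simp
  | insert p P hp ih =>
    have hP' : ∀ p ∈ P, p.1 < p.2 := fun q hq => hP q (Finset.mem_insert_of_mem hq)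
    have hi := ih hP'
    have hd := h.abs_expect_mul_prod_le S hε hQ (hP p (Finset.mem_insert_self p P)) P hP' hp
    set A := 𝔼 e : V → Ω, ∏ q ∈ P, arcWeight S W e q with hA
    set B := 𝔼 e : V → Ω, (W (e p.1) (e p.2) - 1 / 2) * ∏ q ∈ P, arcWeight S W e q with hB
    -- The new factor is `1/2` plus or minus `W - 1/2`, the sign depending on the orientation in
    -- `S`. The first part halves the old error and the second costs at most `ε`.
    have key : ∃ s : ℝ, |s| = 1 ∧
        𝔼 e : V → Ω, ∏ q ∈ insert p P, arcWeight S W e q = A / 2 + s * B := by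
      by_cases hS : S.Adj p.1 p.2
      · refine ⟨1, abs_one, ?_⟩
        have : ∀ e : V → Ω, ∏ q ∈ insert p P, arcWeight S W e q =
            1 / 2 * ∏ q ∈ P, arcWeight S W e q +
              (W (e p.1) (e p.2) - 1 / 2) * ∏ q ∈ P, arcWeight S W e q := fun e => by
          rw [Finset.prod_insert hp, arcWeight, if_pos hS]
          ring
        simp only [this, Finset.expect_add_distrib, ← Finset.mul_expect, ← hA, ← hB]
        ring
      · refine ⟨-1, by simp, ?_⟩
        have : ∀ e : V → Ω, ∏ q ∈ insert p P, arcWeight S W e q =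
            1 / 2 * ∏ q ∈ P, arcWeight S W e q -
              (W (e p.1) (e p.2) - 1 / 2) * ∏ q ∈ P, arcWeight S W e q := fun e => by
          rw [Finset.prod_insert hp, arcWeight, if_neg hS, h.swap (e p.1)]
          ring
        simp only [this, Finset.expect_sub_distrib, ← Finset.mul_expect, ← hA, ← hB]
        ring
    obtain ⟨s, hs, hkey⟩ := key
    rw [hkey, Finset.card_insert_of_notMem hp, pow_succ]
    have h1 : A / 2 + s * B - (1 / 2) ^ P.card * (1 / 2) = (A - (1 / 2) ^ P.card) / 2 + s * B := by
      ring
    have h2 : |s * B| ≤ ε := by rw [abs_mul, hs, one_mul]; exact hd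
    have h3 : |(A - (1 / 2) ^ P.card) / 2| ≤ P.card * ε := by
      rw [abs_div, abs_two]
      linarith [abs_nonneg (A - (1 / 2) ^ P.card)]
    rw [h1]
    push_cast
    linarith [abs_add_le ((A - (1 / 2) ^ P.card) / 2) (s * B)]

/-- The counting lemma with `ε` the fourth root of the discrepancy. Fourth powers keep the right
side linear in the discrepancy, ready for averaging over tournaments. -/
theorem homDens_sub_pow_four_le [Nonempty Ω] (h : IsTournamentKernel W) {k : ℕ}
    (S : Tournament (Fin k)) :
    (homDens S W - 1 / 2 ^ k.choose 2) ^ 4 ≤ (k.choose 2) ^ 4 * discrepancy W := by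
  have hcard : (Finset.univ.filter fun p : Fin k × Fin k => p.1 < p.2).card = k.choose 2 := by
    rw [Fintype.card_product_filter_lt, Fintype.card_fin]
  obtain ⟨ε, hε, hε4⟩ : ∃ ε : ℝ, 0 ≤ ε ∧ ε ^ 4 = discrepancy W := by
    refine ⟨√(√(discrepancy W)), Real.sqrt_nonneg _, ?_⟩
    rw [show 4 = 2 * 2 from rfl, pow_mul, Real.sq_sqrt (Real.sqrt_nonneg _),
      Real.sq_sqrt (discrepancy_nonneg W)]
  have := h.abs_expect_prod_sub_le S hε hε4.ge
    (Finset.univ.filter fun p : Fin k × Fin k => p.1 < p.2) (fun p hp => (Finset.mem_filter.1 hp).2)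
  rw [hcard, div_pow, one_pow] at this
  rw [← hε4, ← mul_pow, ← Even.pow_abs (by decide)]
  exact pow_le_pow_left₀ (abs_nonneg _) this 4

end IsTournamentKernel
end Counting

/-! ### Finite tournaments as kernels -/

/-- A uniformly random injective map is close in distribution to a uniformly random map. -/
theorem abs_expect_embedding_sub_expect_le {k n : ℕ} (hk : k ≤ n) (hn : 0 < n)
    (g : (Fin k → Fin n) → ℝ) (h0 : ∀ e, 0 ≤ g e) (h1 : ∀ e, g e ≤ 1) :
    |𝔼 e : Fin k ↪ Fin n, g e - 𝔼 e, g e| ≤ 1 - (n.descFactorial k : ℝ) / n ^ k := by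
  classical
  have hn' : (0 : ℝ) < (n : ℝ) ^ k := by positivity
  have hd : (0 : ℝ) < n.descFactorial k := by exact_mod_cast Nat.descFactorial_pos.2 hk
  let I : Finset (Fin k → Fin n) := Finset.univ.filter Function.Injective
  have hI : ∀ f : (Fin k → Fin n) → ℝ, ∑ e ∈ I, f e = ∑ e : Fin k ↪ Fin n, f e := fun f => by
    symm
    refine Finset.sum_bij (fun e _ => ⇑e) (fun e _ => ?_) (fun a _ b _ h => DFunLike.coe_injective h)
      (fun e he => ⟨⟨e, (Finset.mem_filter.1 he).2⟩, Finset.mem_univ _, rfl⟩) (fun _ _ => rfl)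
    exact Finset.mem_filter.2 ⟨Finset.mem_univ _, e.injective⟩
  have hsplit : ∀ f : (Fin k → Fin n) → ℝ, ∑ e, f e = ∑ e : Fin k ↪ Fin n, f e + ∑ e ∈ Iᶜ, f e :=
    fun f => by rw [← hI, Finset.sum_add_sum_compl]
  have hcard : (n : ℝ) ^ k = n.descFactorial k + ∑ _e ∈ Iᶜ, (1 : ℝ) := by
    have := hsplit fun _ => 1
    simpa [Fintype.card_embedding_eq] using this
  have hA0 : 0 ≤ ∑ e : Fin k ↪ Fin n, g e := Finset.sum_nonneg fun e _ => h0 e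
  have hA1 : ∑ e : Fin k ↪ Fin n, g e ≤ n.descFactorial k := by
    refine (Finset.sum_le_sum fun (e : Fin k ↪ Fin n) _ => h1 e).trans (le_of_eq ?_)
    simp [Fintype.card_embedding_eq]
  have hB0 : 0 ≤ ∑ e ∈ Iᶜ, g e := Finset.sum_nonneg fun e _ => h0 e
  have hB1 : ∑ e ∈ Iᶜ, g e ≤ ∑ _e ∈ Iᶜ, (1 : ℝ) := Finset.sum_le_sum fun e _ => h1 e
  rw [Fintype.expect_eq_sum_div_card, Fintype.expect_eq_sum_div_card, hsplit g]
  simp only [Fintype.card_embedding_eq, Fintype.card_fin, Fintype.card_fun, Nat.cast_pow]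
  set A := ∑ e : Fin k ↪ Fin n, g e
  set B := ∑ e ∈ Iᶜ, g e
  set C := ∑ _e ∈ Iᶜ, (1 : ℝ)
  set d : ℝ := (n.descFactorial k : ℝ)
  rw [hcard] at hn' ⊢
  have hC : 1 - d / (d + C) = C / (d + C) := by field_simp; ring
  -- Here `d` and `C` count the injective and the other maps. Both `A / d * C` and `B` lie in `[0,
  -- C]`, so the error is at most the probability of non-injectivity.
  have hAB : A / d - (A + B) / (d + C) = (A / d * C - B) / (d + C) := by field_simp; ring
  have hq0 : 0 ≤ A / d := by positivity
  have hq1 : A / d ≤ 1 := (div_le_one hd).2 hA1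
  have hC0 : 0 ≤ C := hB0.trans hB1
  rw [hC, hAB, abs_div, abs_of_pos hn']
  refine div_le_div_of_nonneg_right (abs_le.2 ⟨?_, ?_⟩) hn'.le
  · nlinarith [mul_nonneg hq0 hC0]
  · nlinarith [mul_le_mul_of_nonneg_right hq1 hC0]

theorem tendsto_one_sub_descFactorial_div_pow (k : ℕ) :
    Filter.Tendsto (fun n : ℕ => 1 - (n.descFactorial k : ℝ) / n ^ k) Filter.atTop (nhds 0) := by
  have h := isEquivalent_descFactorial k
  rw [Asymptotics.isEquivalent_iff_tendsto_one] at h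
  · simpa using h.const_sub 1
  · filter_upwards [Filter.eventually_gt_atTop 0] with n hn
    positivity

namespace Tournament

open Classical in
/-- The kernel of a tournament, with value `1/2` on the diagonal. -/
noncomputable def kernel {V : Type*} (T : Tournament V) (x y : V) : ℝ :=
  if x = y then 1 / 2 else if T.Adj x y then 1 else 0

theorem isTournamentKernel_kernel {V : Type*} (T : Tournament V) :
    IsTournamentKernel T.kernel where
  nonneg x y := by unfold kernel; split_ifs <;> norm_num
  add_swap x y := by
    by_cases h : x = y
    · simp only [kernel, h, if_true]; norm_num
    · have h1 := T.asymm x y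
      rcases T.total x y h with h2 | h2
      · simp [kernel, h, Ne.symm h, h2, h1 h2]
      · simp [kernel, h, Ne.symm h, h2, T.asymm y x h2]

-- An injective map avoids the diagonal, so every arc weight is 0 or 1 and records whether the arc
-- agrees with `S`.
open Classical in
theorem prod_arcWeight_kernel {k : ℕ} {V : Type*} (S : Tournament (Fin k)) (T : Tournament V)
    (e : Fin k ↪ V) :
    ∏ p : Fin k × Fin k with p.1 < p.2, arcWeight S T.kernel e p =
      if T.comap e = S then 1 else 0 := by
  have h : ∀ i j, i ≠ j → arcWeight S T.kernel e (i, j) =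
      if (T.Adj (e i) (e j) ↔ S.Adj i j) then 1 else 0 := by
    intro i j hij
    have hne : e i ≠ e j := e.injective.ne hij
    have h1 := T.asymm (e i) (e j)
    by_cases hS : S.Adj i j
    · simp [arcWeight, kernel, hS, hne]
    · rcases T.total _ _ hne with h2 | h2
      · simp [arcWeight, kernel, hS, hne.symm, h2, h1 h2]
      · simp [arcWeight, kernel, hS, hne.symm, h2, T.asymm _ _ h2]
  split_ifs with hT
  · refine Finset.prod_eq_one fun p hp => ?_
    rw [h p.1 p.2 (Finset.mem_filter.1 hp).2.ne, if_pos]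
    rw [← hT]
    rfl
  · have : ∃ i j, i < j ∧ ¬ (T.Adj (e i) (e j) ↔ S.Adj i j) := by
      by_contra! hall
      refine hT ?_
      ext i j
      change T.Adj (e i) (e j) ↔ S.Adj i j
      rcases lt_trichotomy i j with hij | rfl | hij
      · exact hall i j hij
      · exact ⟨fun h => absurd h (T.asymm _ _ h), fun h => absurd h (S.asymm _ _ h)⟩
      · have h0 := hall j i hij
        have h1 := S.total i j hij.ne'
        have h2 := T.total (e i) (e j) (e.injective.ne hij.ne')
        have h3 := S.asymm i j
        have h4 := T.asymm (e i) (e j)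
        tauto
    obtain ⟨i, j, hij, hne⟩ := this
    refine Finset.prod_eq_zero (i := (i, j)) (Finset.mem_filter.2 ⟨Finset.mem_univ _, hij⟩) ?_
    rw [h i j hij.ne, if_neg hne]

/-- A tournament is determined by its arcs between increasing pairs of vertices. -/
noncomputable def equivPairs (V : Type*) [LinearOrder V] :
    Tournament V ≃ ({p : V × V // p.1 < p.2} → Prop) where
  toFun T p := T.Adj p.1.1 p.1.2
  invFun f :=
    { Adj := fun v w => (∃ h : v < w, f ⟨(v, w), h⟩) ∨ ∃ h : w < v, ¬ f ⟨(w, v), h⟩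
      asymm := by
        rintro v w (⟨h, hf⟩ | ⟨h, hf⟩) (⟨h', hf'⟩ | ⟨h', hf'⟩)
        · exact h.asymm h'
        · exact hf' hf
        · exact hf hf'
        · exact h.asymm h'
      total := by
        intro v w hvw
        rcases lt_or_gt_of_ne hvw with h | h
        · by_cases hf : f ⟨(v, w), h⟩
          · exact Or.inl (Or.inl ⟨h, hf⟩)
          · exact Or.inr (Or.inr ⟨h, hf⟩)
        · by_cases hf : f ⟨(w, v), h⟩
          · exact Or.inr (Or.inl ⟨h, hf⟩)
          · exact Or.inl (Or.inr ⟨h, hf⟩) }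
  left_inv T := by
    ext v w
    change ((∃ _ : v < w, T.Adj v w) ∨ ∃ _ : w < v, ¬ T.Adj w v) ↔ T.Adj v w
    have h1 := T.asymm v w
    rcases lt_trichotomy v w with h | rfl | h
    · simp [h, h.asymm]
    · simpa using h1
    · have := T.total v w h.ne'
      simp only [h, h.asymm, exists_prop, true_and, false_and, false_or]
      tauto
  right_inv f := by
    funext ⟨⟨v, w⟩, h⟩
    have h : v < w := h
    change ((∃ h : v < w, f ⟨(v, w), h⟩) ∨ ∃ h : w < v, ¬ f ⟨(w, v), h⟩) = _
    simp [h, h.asymm]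

theorem card_tournament (k : ℕ) : Fintype.card (Tournament (Fin k)) = 2 ^ k.choose 2 := by
  classical
  rw [Fintype.card_congr (equivPairs (Fin k)), Fintype.card_fun, Fintype.card_prop,
    Fintype.card_subtype, Fintype.card_product_filter_lt, Fintype.card_fin]

end Tournament

/-! ### Labelled and unlabelled densities. -/

namespace TournamentFlags

open Tournament

open Classical in
/-- The probability that a random injective map into `T` induces exactly `S`. -/
noncomputable def labelledDens {k n : ℕ} (S : Tournament (Fin k)) (T : Tournament (Fin n)) : ℝ :=
  𝔼 e : Fin k ↪ Fin n, if T.comap e = S then 1 else 0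

open Classical in
/-- The number of tournaments on `Fin k` that are isomorphic to `S`. -/
noncomputable def classCard {k : ℕ} (S : Tournament (Fin k)) : ℕ :=
  (Finset.univ.filter fun S' => cls S' = cls S).card

theorem classCard_pos {k : ℕ} (S : Tournament (Fin k)) : 0 < classCard S :=
  Finset.card_pos.2 ⟨S, by simp⟩

open Classical in
theorem ind_cls {k : ℕ} (S T : Tournament (Fin k)) :
    ind (cls S) T = ∑ S' with cls S' = cls S, if T = S' then 1 else 0 := by
  rw [Finset.sum_ite_eq, ind]
  simp

theorem labelledDens_comap {k n : ℕ} (S : Tournament (Fin k)) (T : Tournament (Fin n))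
    (σ : Fin k ≃ Fin k) : labelledDens (S.comap σ.toEmbedding) T = labelledDens S T := by
  classical
  refine Fintype.expect_equiv (Equiv.embeddingCongr σ (Equiv.refl _)) _ _ fun e => ?_
  congr 1
  refine propext ⟨fun h => ?_, fun h => ?_⟩
  · have : T.comap (σ.symm.toEmbedding.trans e) =
      (S.comap σ.toEmbedding).comap σ.symm.toEmbedding := by rw [← h]; rfl
    refine Eq.trans ?_ (this.trans ?_)
    · rfl
    · ext v w; simp [Tournament.comap]
  · rw [← h]
    ext v w
    simp [Tournament.comap]

/-- The labelled tournaments in one class are relabellings of each other and hence equally dense. -/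
theorem dens_cls {k n : ℕ} (S : Tournament (Fin k)) (T : Tournament (Fin n)) :
    dens (cls S) T = classCard S * labelledDens S T := by
  classical
  simp only [dens, ind_cls, Finset.expect_sum_comm]
  have : ∀ S' ∈ Finset.univ.filter fun S' => cls S' = cls S,
      𝔼 e : Fin k ↪ Fin n, (if T.comap e = S' then (1 : ℝ) else 0) = labelledDens S T := by
    intro S' hS'
    obtain ⟨σ, rfl⟩ := Iso.comap (Quotient.exact (Finset.mem_filter.1 hS').2)
    rw [← labelledDens_comap S T σ, labelledDens]
  rw [Finset.sum_congr rfl this, Finset.sum_const, nsmul_eq_mul, classCard]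

theorem rdm_cls {k : ℕ} (S : Tournament (Fin k)) : rdm (cls S) = classCard S / 2 ^ k.choose 2 := by
  classical
  rw [rdm, Fintype.expect_eq_sum_div_card, card_tournament]
  congr 1
  · simp [ind, classCard]
  · norm_cast

theorem classCard_transitive (k : ℕ) : classCard (transitive (Fin k)) = k.factorial := by
  classical
  rw [classCard, ← Fintype.card_fin k, ← Fintype.card_perm, Fintype.card_fin, ← Finset.card_univ]
  symm
  refine Finset.card_bij (fun σ _ => (transitive (Fin k)).comap (Equiv.toEmbedding σ))
    (fun σ _ => Finset.mem_filter.2 ⟨Finset.mem_univ _, cls_comap _ σ⟩) ?_ ?_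
  · intro σ _ τ _ h
    have hadj : ∀ i j, σ i < σ j ↔ τ i < τ j := fun i j =>
      iff_of_eq (congrFun (congrFun (congrArg (fun T => T.Adj) h) i) j)
    -- Two permutations giving the same relabelling differ by an order automorphism of `Fin k`,
    -- which is trivial.
    let f : Fin k ≃o Fin k := ⟨σ.symm.trans τ, fun {a b} => by
      have := hadj (σ.symm b) (σ.symm a)
      simp only [Equiv.apply_symm_apply] at this
      simp only [Equiv.trans_apply, ← not_lt, this]⟩
    ext i
    have := DFunLike.congr_fun (Subsingleton.elim f (OrderIso.refl _)) (σ i)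
    have h2 : τ i = σ i := by simpa [f] using this
    rw [h2]
  · intro S hS
    obtain ⟨σ, rfl⟩ := Iso.comap (Quotient.exact (Finset.mem_filter.1 hS).2)
    exact ⟨σ, Finset.mem_univ _, rfl⟩

theorem abs_labelledDens_sub_homDens_le {k n : ℕ} (hk : k ≤ n) (hn : 0 < n)
    (S : Tournament (Fin k)) (T : Tournament (Fin n)) :
    |labelledDens S T - homDens S T.kernel| ≤ 1 - (n.descFactorial k : ℝ) / n ^ k := by
  have hT := T.isTournamentKernel_kernel
  have := abs_expect_embedding_sub_expect_le hk hn
    (fun e => ∏ p : Fin k × Fin k with p.1 < p.2, arcWeight S T.kernel e p)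
    (fun e => Finset.prod_nonneg fun p _ => hT.arcWeight_nonneg S e p)
    (fun e => Finset.prod_le_one (fun p _ => hT.arcWeight_nonneg S e p)
      fun p _ => hT.arcWeight_le_one S e p)
  simp only [prod_arcWeight_kernel] at this
  exact this

/-! ### Homomorphisms as averages over finite tournaments -/

/-- The average of `f` over the random tournament with `n` vertices given by `φ`. -/
noncomputable def average (φ : PosHom) (n : ℕ) (f : Tournament (Fin n) → ℝ) : ℝ :=
  ∑ G : Model n, φ.1 (flag G) * f G.out

/-- Expand the unit, the empty tournament, on `n` vertices: it has density one in everything. With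
positivity, `φ` becomes a probability distribution. -/
theorem sum_flag (φ : PosHom) (n : ℕ) : ∑ G : Model n, φ.1 (flag G) = 1 := by
  have h := congrArg φ.1 (flag_eq_sum (Nat.zero_le n) (cls (transitive (Fin 0))))
  rw [← one_def, map_one, map_sum] at h
  rw [h]
  refine Finset.sum_congr rfl fun G _ => ?_
  obtain ⟨T, rfl⟩ := cls_surjective G
  have h0 : ∀ S : Tournament (Fin 0), ind (cls (transitive (Fin 0))) S = 1 := by
    intro S
    have : S = transitive (Fin 0) := by ext v; exact v.elim0
    simp [ind, this]
  have := nonempty_emb (Nat.zero_le n)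
  rw [map_smul, p_cls, dens]
  simp only [h0, Fintype.expect_const, one_smul]

theorem average_mono (φ : PosHom) {n : ℕ} {f g : Tournament (Fin n) → ℝ} (h : ∀ T, f T ≤ g T) :
    average φ n f ≤ average φ n g :=
  Finset.sum_le_sum fun G _ => mul_le_mul_of_nonneg_left (h _) (φ.2 n G)

theorem average_const (φ : PosHom) (n : ℕ) (c : ℝ) : average φ n (fun _ => c) = c := by
  rw [average, ← Finset.sum_mul, sum_flag, one_mul]

theorem average_const_mul (φ : PosHom) (n : ℕ) (c : ℝ) (f : Tournament (Fin n) → ℝ) :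
    average φ n (fun T => c * f T) = c * average φ n f := by
  simp only [average, Finset.mul_sum, mul_left_comm]

theorem average_add (φ : PosHom) (n : ℕ) (f g : Tournament (Fin n) → ℝ) :
    average φ n (fun T => f T + g T) = average φ n f + average φ n g := by
  simp only [average, mul_add, Finset.sum_add_distrib]

theorem average_sub (φ : PosHom) (n : ℕ) (f g : Tournament (Fin n) → ℝ) :
    average φ n (fun T => f T - g T) = average φ n f - average φ n g := by
  simp only [average, mul_sub, Finset.sum_sub_distrib]

theorem average_pow_four_le (φ : PosHom) (n : ℕ) (f : Tournament (Fin n) → ℝ) :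
    average φ n f ^ 4 ≤ average φ n (fun T => f T ^ 4) :=
  Real.pow_arith_mean_le_arith_mean_pow_of_even _ _ _ (fun G _ => φ.2 n G) (sum_flag φ n)
    (by decide)

theorem flag_eq_average (φ : PosHom) {k n : ℕ} (h : k ≤ n) (S : Tournament (Fin k)) :
    φ.1 (flag (cls S)) = classCard S * average φ n (labelledDens S) := by
  rw [flag_eq_sum h, map_sum, average, Finset.mul_sum]
  refine Finset.sum_congr rfl fun G _ => ?_
  have hG : p (cls S) G = dens (cls S) G.out := by
    conv_lhs => rw [← Quotient.out_eq G]
    rfl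
  rw [map_smul, smul_eq_mul, hG, dens_cls]
  ring

/-- The average labelled density equals the limit for every `n ≥ k`, and replacing it by `homDens`
costs the probability of non-injectivity, uniformly in the tournament. -/
theorem tendsto_average_homDens (φ : PosHom) {k : ℕ} (S : Tournament (Fin k)) :
    Filter.Tendsto (fun n => average φ n fun T => homDens S T.kernel) Filter.atTop
      (nhds (φ.1 (flag (cls S)) / classCard S)) := by
  rw [tendsto_iff_dist_tendsto_zero]
  refine squeeze_zero' (Filter.Eventually.of_forall fun n => dist_nonneg) ?_
    (tendsto_one_sub_descFactorial_div_pow k)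
  filter_upwards [Filter.eventually_ge_atTop k, Filter.eventually_gt_atTop 0] with n hk hn
  have hpos : (0 : ℝ) < classCard S := by exact_mod_cast classCard_pos S
  rw [dist_comm, Real.dist_eq, flag_eq_average φ hk, mul_div_cancel_left₀ _ hpos.ne', ← average_sub]
  have h := fun T => abs_le.1 (abs_labelledDens_sub_homDens_le hk hn S T)
  refine abs_le.2 ⟨?_, ?_⟩
  · rw [← average_const φ n (-_)]
    exact average_mono φ fun T => (h T).1
  · rw [← average_const φ n (1 - _)]
    exact average_mono φ fun T => (h T).2

/-! ### The minimum and the case of equality. -/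

theorem phiRdm_flag {n : ℕ} (F : Model n) : phiRdm.1 (flag F) = rdm F := rdmLin_flag F

theorem phiRdm_Tr (k : ℕ) : phiRdm.1 (Tr k) = (k.factorial : ℝ) / 2 ^ k.choose 2 := by
  rw [Tr, phiRdm_flag, rdm_cls, classCard_transitive]

theorem nonempty_fin {n : ℕ} (hn : 0 < n) : Nonempty (Fin n) := ⟨⟨0, hn⟩⟩

theorem le_homDens_transitive {n : ℕ} (hn : 0 < n) (k : ℕ) (T : Tournament (Fin n)) :
    1 / 2 ^ k.choose 2 ≤ homDens (transitive (Fin k)) T.kernel := by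
  have := nonempty_fin hn
  rw [homDens_transitive]
  simpa [Fintype.expect_const] using
    T.isTournamentKernel_kernel.le_transDens k (fun _ => 1) fun _ => zero_le_one

theorem le_Tr (k : ℕ) (φ : PosHom) : (k.factorial : ℝ) / 2 ^ k.choose 2 ≤ φ.1 (Tr k) := by
  have h := tendsto_average_homDens φ (transitive (Fin k))
  have hpos : (0 : ℝ) < k.factorial := by exact_mod_cast k.factorial_pos
  rw [classCard_transitive] at h
  have h2 : 1 / 2 ^ k.choose 2 ≤ φ.1 (Tr k) / k.factorial := by
    refine ge_of_tendsto h ?_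
    filter_upwards [Filter.eventually_gt_atTop 0] with n hn
    rw [← average_const φ n (1 / _)]
    exact average_mono φ (le_homDens_transitive hn k)
  rw [le_div_iff₀ hpos] at h2
  rwa [← mul_one_div, mul_comm]

/-- If `φ` minimizes the density of transitive tournaments, its average discrepancy tends to zero. -/
theorem tendsto_average_discrepancy {k : ℕ} (hk : 4 ≤ k) {φ : PosHom}
    (h : φ.1 (Tr k) = (k.factorial : ℝ) / 2 ^ k.choose 2) :
    Filter.Tendsto (fun n => average φ n fun T => discrepancy T.kernel) Filter.atTop (nhds 0) := by
  obtain ⟨r, rfl⟩ := Nat.exists_eq_add_of_le' hk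
  set δ : ℝ := (1 / 4) ^ r / 8 / 2 ^ (r + 2).choose 2 with hδ
  have hδ0 : 0 < δ := by positivity
  have hlim := tendsto_average_homDens φ (transitive (Fin (r + 4)))
  have hpos : ((r + 4).factorial : ℝ) ≠ 0 := by exact_mod_cast (r + 4).factorial_ne_zero
  rw [classCard_transitive, ← Tr, h, div_div_cancel_left' hpos, ← one_div] at hlim
  -- By `discrepancy_le`, the average discrepancy is at most `δ⁻¹` times the excess transitive
  -- density, which vanishes in the limit.
  have hlim' := (hlim.sub_const (1 / 2 ^ (r + 4).choose 2)).const_mul δ⁻¹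
  rw [sub_self, mul_zero] at hlim'
  refine squeeze_zero' (Filter.Eventually.of_forall fun n => ?_) ?_ hlim'
  · rw [← average_const φ n 0]
    exact average_mono φ fun T => discrepancy_nonneg _
  · filter_upwards [Filter.eventually_gt_atTop 0] with n hn
    have := nonempty_fin hn
    rw [← div_eq_inv_mul, le_div_iff₀' hδ0, le_sub_iff_add_le', ← average_const_mul,
      ← average_const φ n (1 / _), ← average_add]
    refine average_mono φ fun T => ?_
    rw [homDens_transitive]
    exact T.isTournamentKernel_kernel.discrepancy_le r

/-- By Jensen and the counting lemma, the fourth power of the deviation of each labelled density is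
at most a constant times the average discrepancy, hence zero in the limit. -/
theorem eq_phiRdm {k : ℕ} (hk : 4 ≤ k) {φ : PosHom}
    (h : φ.1 (Tr k) = (k.factorial : ℝ) / 2 ^ k.choose 2) : φ = phiRdm := by
  have hflag : ∀ (m : ℕ) (F : Model m), φ.1 (flag F) = phiRdm.1 (flag F) := by
    intro m F
    obtain ⟨S, rfl⟩ := cls_surjective F
    have hpos : (classCard S : ℝ) ≠ 0 := by exact_mod_cast (classCard_pos S).ne'
    have hlim := (tendsto_average_homDens φ S).sub_const (1 / 2 ^ m.choose 2) |>.pow 4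
    have hzero := (tendsto_average_discrepancy hk h).const_mul ((m.choose 2 : ℝ) ^ 4)
    rw [mul_zero] at hzero
    have hle : (φ.1 (flag (cls S)) / classCard S - 1 / 2 ^ m.choose 2) ^ 4 ≤ 0 := by
      refine le_of_tendsto_of_tendsto hlim hzero ?_
      filter_upwards [Filter.eventually_gt_atTop 0] with n hn
      have := nonempty_fin hn
      rw [← average_const φ n (1 / _), ← average_sub, ← average_const_mul]
      refine (average_pow_four_le φ n _).trans (average_mono φ fun T => ?_)
      exact T.isTournamentKernel_kernel.homDens_sub_pow_four_le S
    have heq := pow_eq_zero_iff (by norm_num) |>.1 (le_antisymm hle (by positivity))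
    rw [sub_eq_zero, div_eq_iff hpos] at heq
    rw [heq, phiRdm_flag, rdm_cls, one_div_mul_eq_div]
  exact Subtype.ext (AlgHom.toLinearMap_injective (linearMap_ext hflag))

end TournamentFlags

theorem theorem1 :
    (∀ (k : ℕ) (φ : TournamentFlags.PosHom),
      (k.factorial : ℝ) / 2 ^ k.choose 2 ≤ φ.1 (TournamentFlags.Tr k)) ∧
    (∀ k : ℕ,
      TournamentFlags.phiRdm.1 (TournamentFlags.Tr k) = (k.factorial : ℝ) / 2 ^ k.choose 2) ∧
    (∀ k : ℕ, 4 ≤ k → ∀ φ : TournamentFlags.PosHom,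
      (φ.1 (TournamentFlags.Tr k) = (k.factorial : ℝ) / 2 ^ k.choose 2 ↔
        φ = TournamentFlags.phiRdm)) := by
  exact ⟨TournamentFlags.le_Tr, TournamentFlags.phiRdm_Tr, fun _ hk _ =>
    ⟨TournamentFlags.eq_phiRdm hk, fun h => h ▸ TournamentFlags.phiRdm_Tr _⟩⟩
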